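/- Let $(N,g)$ be a smooth connected (Hausdorff, second countable, finite-dimensional, boundaryless) Riemannian manifold with Riemannian volume measure $\operatorname{vol}(g)$. Let $\operatorname{Diff}_c(N)$ be the group of smooth diffeomorphisms of $N$ with compact support. A smooth path in $\operatorname{Diff}_c(N)$ is a family $(\varphi(t,\cdot))_{t\in[0,1]}$ in $\operatorname{Diff}_c(N)$ such that $(t,x)\mapsto\varphi(t,x)$ is smooth on $[0,1]\times N$ and all $\varphi(t,\cdot)$ are the identity outside one common compact set. Let $\operatorname{Diff}_0(N)$ be the subgroup of those elements that are joined to the identity by a smooth path in $\operatorname{Diff}_c(N)$. For vector fields $h,k$ along $\varphi\in\operatorname{Diff}_0(N)$ put $X=h\circ\varphi^{-1}$, $Y=k\circ\varphi^{-1}$ and, for $A>0$, $$G^0_\varphi(h,k)=\int_N g(X,Y)\,\operatorname{vol}(g),\qquad G^A_\varphi(h,k)=\int_N\bigl(g(X,Y)+A\,\operatorname{div}_g(X)\operatorname{div}_g(Y)\bigr)\operatorname{vol}(g).$$ The length of a smooth path $\varphi$ with respect to a metric $G$ is $\int_0^1\sqrt{G_{\varphi(t)}(\partial_t\varphi,\partial_t\varphi)}\,dt$,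 and the geodesic distance of two elements of a subgroup is the infimum (in $[0,\infty]$) of the lengths of all smooth paths in that subgroup which join them. Then: 1. For every $A>0$ and any two distinct $\varphi_0,\varphi_1\in\operatorname{Diff}_0(N)$, the geodesic distance from $\varphi_0$ to $\varphi_1$ in $\operatorname{Diff}_0(N)$ with respect to $G^A$ is positive. 2. For any two distinct elements $\varphi_0,\varphi_1$ of the subgroup of all volume preserving diffeomorphisms in $\operatorname{Diff}_0(N)$ (those with $\varphi_*\operatorname{vol}(g)=\operatorname{vol}(g)$), the geodesic distance from $\varphi_0$ to $\varphi_1$ in this subgroup with respect to $G^0$ is positive. -/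

import Mathlib

open Set MeasureTheory
open scoped Manifold ContDiff ENNReal

noncomputable section

namespace DiffGroup

variable {n : ℕ} {N : Type*} [TopologicalSpace N] [ChartedSpace (EuclideanSpace ℝ (Fin n)) N]
  [IsManifold (𝓡 n) ∞ N]

/-- Smooth Riemannian metrics on the tangent bundle of the `n`-dimensional manifold `N`. -/
abbrev Metric (n : ℕ) (N : Type*) [TopologicalSpace N]
    [ChartedSpace (EuclideanSpace ℝ (Fin n)) N] [IsManifold (𝓡 n) ∞ N] :=
  Bundle.ContMDiffRiemannianMetric (𝓡 n) ∞ (EuclideanSpace ℝ (Fin n))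
    (fun x : N => TangentSpace (𝓡 n) x)

/-- The coordinate vector field `∂ᵢ` of the chart centred at `c`, at the point of `N` with
coordinates `y`. -/
def coordVector (c : N) (y : EuclideanSpace ℝ (Fin n)) (i : Fin n) :
    TangentSpace (𝓡 n) ((extChartAt (𝓡 n) c).symm y) :=
  mfderiv (𝓡 n) (𝓡 n) (extChartAt (𝓡 n) c).symm y (EuclideanSpace.single i (1 : ℝ))

/-- The density `√(det (gᵢⱼ))` of the Riemannian volume in the chart centred at `c`. -/
def volDensity (g : Metric n N) (c : N) (y : EuclideanSpace ℝ (Fin n)) : ℝ :=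
  √(Matrix.of fun i j : Fin n =>
    g.inner ((extChartAt (𝓡 n) c).symm y) (coordVector c y i) (coordVector c y j)).det

/-- The Riemannian volume of the domain of the chart centred at `c`: the image in `N` of the measure
`√(det (gᵢⱼ)) dy` on the target of the chart. -/
def chartVolume [MeasurableSpace N] (g : Metric n N) (c : N) : Measure N :=
  ((volume.restrict (extChartAt (𝓡 n) c).target).withDensity
    fun y => ENNReal.ofReal (volDensity g c y)).map (extChartAt (𝓡 n) c).symm

/-- The Riemannian volume measure `vol(g)`. The measures of the single charts agree on the overlaps
of their domains, and `vol(g)` is the smallest measure that dominates all of them, that is, the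
measure which restricts to `√(det (gᵢⱼ)) dy` on each chart. -/
def vol [MeasurableSpace N] (g : Metric n N) : Measure N :=
  ⨆ c : N, chartVolume g c

/-- The components of the vector field `X` in the chart centred at `c`, as functions of the
coordinates. -/
def components (c : N) (X : ∀ x : N, TangentSpace (𝓡 n) x) (y : EuclideanSpace ℝ (Fin n)) :
    EuclideanSpace ℝ (Fin n) :=
  mfderiv (𝓡 n) (𝓡 n) (extChartAt (𝓡 n) c) ((extChartAt (𝓡 n) c).symm y)
    (X ((extChartAt (𝓡 n) c).symm y))

/-- The divergence `(1/√G) ∑ᵢ ∂ᵢ(√G Xⁱ)`, `G = det (gᵢⱼ)`, of a vector field, computed at `x` in the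
chart centred at `x`. -/
def divergence (g : Metric n N) (X : ∀ x : N, TangentSpace (𝓡 n) x) (x : N) : ℝ :=
  (volDensity g x (extChartAt (𝓡 n) x x))⁻¹ *
    ∑ i : Fin n, fderiv ℝ (fun y => volDensity g x y * components x X y i)
      (extChartAt (𝓡 n) x x) (EuclideanSpace.single i (1 : ℝ))

/-- Smooth diffeomorphisms of `N`. -/
abbrev Diff (n : ℕ) (N : Type*) [TopologicalSpace N]
    [ChartedSpace (EuclideanSpace ℝ (Fin n)) N] :=
  Diffeomorph (𝓡 n) (𝓡 n) N N ∞

/-- The diffeomorphisms with compact support. -/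
def diffC (n : ℕ) (N : Type*) [TopologicalSpace N]
    [ChartedSpace (EuclideanSpace ℝ (Fin n)) N] : Set (Diff n N) :=
  {φ | ∃ K : Set N, IsCompact K ∧ ∀ x ∉ K, φ x = x}

/-- `φ`, restricted to `[0, 1]`, is a smooth path from `φ₀` to `φ₁` in the set `S` of compactly
supported diffeomorphisms: the map `(t, x) ↦ φ t x` is smooth on `[0, 1] × N`, and the supports of
all the `φ t` lie in one compact set. -/
structure IsSmoothPath (S : Set (Diff n N)) (φ₀ φ₁ : Diff n N) (φ : ℝ → Diff n N) : Prop where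
  smooth : ContMDiffOn (𝓘(ℝ, ℝ).prod (𝓡 n)) (𝓡 n) ∞ (fun p : ℝ × N => φ p.1 p.2)
    (Icc (0 : ℝ) 1 ×ˢ univ)
  compactSupport : ∃ K : Set N, IsCompact K ∧ ∀ t ∈ Icc (0 : ℝ) 1, ∀ x ∉ K, φ t x = x
  mem : ∀ t ∈ Icc (0 : ℝ) 1, φ t ∈ S
  source : φ 0 = φ₀
  target : φ 1 = φ₁

/-- The group of the diffeomorphisms that are diffeotopic to the identity through compactly
supported diffeomorphisms. -/
def diff0 (n : ℕ) (N : Type*) [TopologicalSpace N]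
    [ChartedSpace (EuclideanSpace ℝ (Fin n)) N] : Set (Diff n N) :=
  {ψ | ∃ φ : ℝ → Diff n N, IsSmoothPath (diffC n N) (Diffeomorph.refl (𝓡 n) N ∞) ψ φ}

/-- The subgroup of the volume preserving elements of `diff0 n N`. -/
def volDiff0 [MeasurableSpace N] (g : Metric n N) : Set (Diff n N) :=
  {φ | φ ∈ diff0 n N ∧ MeasurePreserving φ (vol g) (vol g)}

/-- The vector field `h ∘ φ⁻¹` on `N` that belongs to a vector field `h` along `φ`. The value at `y`
is a tangent vector at `φ (φ⁻¹ y) = y`. -/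
def rightTranslate (φ : Diff n N) (h : ∀ x : N, TangentSpace (𝓡 n) (φ x)) (y : N) :
    TangentSpace (𝓡 n) y :=
  (φ.apply_symm_apply y) ▸ h (φ.symm y)

/-- The right invariant `H⁰`-metric, on vector fields `h`, `k` along `φ`. -/
def metricH0 [MeasurableSpace N] (g : Metric n N) (φ : Diff n N)
    (h k : ∀ x : N, TangentSpace (𝓡 n) (φ x)) : ℝ :=
  ∫ y, g.inner y (rightTranslate φ h y) (rightTranslate φ k y) ∂(vol g)

/-- The right invariant metric `G^A`, on vector fields `h`, `k` along `φ`. -/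
def metricA [MeasurableSpace N] (g : Metric n N) (A : ℝ) (φ : Diff n N)
    (h k : ∀ x : N, TangentSpace (𝓡 n) (φ x)) : ℝ :=
  ∫ y, (g.inner y (rightTranslate φ h y) (rightTranslate φ k y) +
    A * (divergence g (rightTranslate φ h) y * divergence g (rightTranslate φ k) y)) ∂(vol g)

/-- The time derivative `∂ₜ φ` at time `t ∈ [0, 1]` (one-sided at the ends), a vector field along
`φ t`. -/
def velocity (φ : ℝ → Diff n N) (t : ℝ) (x : N) : TangentSpace (𝓡 n) (φ t x) :=
  mfderivWithin 𝓘(ℝ, ℝ) (𝓡 n) (fun s => φ s x) (Icc (0 : ℝ) 1) t (1 : ℝ)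

/-- The length `∫₀¹ √(G(∂ₜφ, ∂ₜφ)) dt` of a path for a metric `G` on a group of diffeomorphisms. -/
def pathLength (G : ∀ φ : Diff n N, (∀ x : N, TangentSpace (𝓡 n) (φ x)) →
    (∀ x : N, TangentSpace (𝓡 n) (φ x)) → ℝ) (φ : ℝ → Diff n N) : ℝ≥0∞ :=
  ∫⁻ t in Icc (0 : ℝ) 1, ENNReal.ofReal √(G (φ t) (velocity φ t) (velocity φ t))

/-- The geodesic distance in `S` for the metric `G`: the infimum of the lengths of all smooth paths
in `S` from `φ₀` to `φ₁`. -/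
def geodesicDist (G : ∀ φ : Diff n N, (∀ x : N, TangentSpace (𝓡 n) (φ x)) →
    (∀ x : N, TangentSpace (𝓡 n) (φ x)) → ℝ) (S : Set (Diff n N)) (φ₀ φ₁ : Diff n N) : ℝ≥0∞ :=
  ⨅ (φ : ℝ → Diff n N) (_ : IsSmoothPath S φ₀ φ₁ φ), pathLength G φ

end DiffGroup

end

/-! Both distances are bounded below by one device: a test quantity that separates the end points
and whose time derivative along any path is at most a constant, independent of the path, times the
norm of the velocity. Write `X = ∂ₜφ ∘ φ⁻¹`. For a bump function `ρ` with support in one chart,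
compactness gives `|dρ(X)| ≤ C |X|_g` on `tsupport ρ`, with `C` independent of `X`
(`exists_abs_dirDeriv_le`); Cauchy–Schwarz on this set of finite volume turns the integral of
`|X|_g` into `√G⁰`.

Volume preserving case (`geodesicDist_metricH0_pos`): take `ρ` equal to `1` at `φ₁ x₀` and `0` at
`φ₀ x₀`. Since `∂ₜ(ρ ∘ φ) = dρ(X) ∘ φ`, the `L¹` distance `δ > 0` of `ρ ∘ φ₀` and `ρ ∘ φ₁` is at
most `∫₀¹ ∫ |dρ(X)| ∘ φ dvol dt`. Volume preservation removes the inner `φ`, and Cauchy–Schwarz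
bounds the rest by a constant times the length.

Case `G^A` (`geodesicDist_metricA_pos`): the Jacobian of `φ t` is now uncontrolled, so the test
quantity is `u(t) = ∫ ρ · (f ∘ φ⁻¹) dvol`, where `f` separates `φ₀⁻¹ c` from `φ₁⁻¹ c` and `ρ`
localizes near `c`. The transport equation `∂ₜ(f ∘ φ⁻¹) = -d(f ∘ φ⁻¹)(X)` and integration by parts
give `u' = ∫ (f ∘ φ⁻¹)(dρ(X) + ρ div X) dvol` (`hasDerivAt_integral_transport`). The first term is
controlled by `√G⁰`, the second by the divergence part of `G^A`, which costs the factor `1/√A`.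

The remaining work is foundational: `vol` is given by its density in every chart, the divergence
does not depend on the chart, and `φ⁻¹` is jointly smooth in time and space. -/

noncomputable section

namespace DiffGroup

open Filter Topology

set_option linter.unusedSectionVars false

/-! ### Derivative of the determinant and the Piola identity. -/

section Calculus

variable {E : Type*} [NormedAddCommGroup E] [NormedSpace ℝ E] [FiniteDimensional ℝ E]

theorem contDiff_clm_det {m : WithTop ℕ∞} : ContDiff ℝ m (fun A : E →L[ℝ] E => A.det) := by
  let b := Module.finBasis ℝ E
  have h : (fun A : E →L[ℝ] E => A.det) =
      fun A : E →L[ℝ] E => ∑ σ : Equiv.Perm (Fin (Module.finrank ℝ E)),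
        (Equiv.Perm.sign σ : ℝ) * ∏ i, b.coord (σ i) (A (b i)) := by
    funext A
    rw [ContinuousLinearMap.det, ← LinearMap.det_toMatrix b, Matrix.det_apply']
    simp [LinearMap.toMatrix_apply]
  rw [h]
  have hc : ∀ i j, ContDiff ℝ m (fun A : E →L[ℝ] E => b.coord j (A (b i))) := fun i j =>
    ((LinearMap.toContinuousLinearMap (b.coord j)).comp
      (ContinuousLinearMap.apply ℝ E (b i))).contDiff
  exact ContDiff.sum fun σ _ => contDiff_const.mul (contDiff_prod fun i _ => hc i (σ i))

theorem hasDerivAt_det_one_add_smul (A : E →ₗ[ℝ] E) :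
    HasDerivAt (fun s : ℝ => LinearMap.det (1 + s • A)) (LinearMap.trace ℝ E A) 0 := by
  let b := Module.finBasis ℝ E
  let M := LinearMap.toMatrix b b A
  have h1 := (Matrix.det (1 + (Polynomial.X : Polynomial ℝ) • M.map Polynomial.C)).hasDerivAt 0
  rw [Matrix.derivative_det_one_add_X_smul] at h1
  rw [LinearMap.trace_eq_matrix_trace ℝ b]
  refine h1.congr_of_eventuallyEq (Eventually.of_forall fun s => ?_)
  dsimp only
  rw [← LinearMap.det_toMatrix b, ← Polynomial.coe_evalRingHom, RingHom.map_det]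
  congr 1
  rw [map_add, map_smul, LinearMap.toMatrix_one]
  ext i j
  by_cases h : i = j <;> simp [h, M, mul_comm s]

/-- **Jacobi's formula** for the derivative of the determinant at an invertible map. -/
theorem exists_hasFDerivAt_det (B : E ≃L[ℝ] E) :
    ∃ D : (E →L[ℝ] E) →L[ℝ] ℝ,
      HasFDerivAt (fun A : E →L[ℝ] E => A.det) D (B : E →L[ℝ] E) ∧
      ∀ C : E →L[ℝ] E, D C = (B : E →L[ℝ] E).det *
        LinearMap.trace ℝ E ((B.symm : E →L[ℝ] E) ∘L C : E →L[ℝ] E) := by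
  refine ⟨_, ((contDiff_clm_det (m := 1)).differentiable (by norm_num)
    (B : E →L[ℝ] E)).hasFDerivAt, fun C => ?_⟩
  set D := fderiv ℝ (fun A : E →L[ℝ] E => A.det) (B : E →L[ℝ] E) with hD
  have h1 : HasDerivAt (fun s : ℝ => ((B : E →L[ℝ] E) + s • C).det) (D C) 0 := by
    have hl : HasDerivAt (fun s : ℝ => (B : E →L[ℝ] E) + s • C) C 0 := by
      simpa using ((hasDerivAt_id (0 : ℝ)).smul_const C).const_add (B : E →L[ℝ] E)
    have h0 : HasFDerivAt (fun A : E →L[ℝ] E => A.det) D ((B : E →L[ℝ] E) + (0 : ℝ) • C) := by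
      simpa using ((contDiff_clm_det (m := 1)).differentiable (by norm_num)
    (B : E →L[ℝ] E)).hasFDerivAt
    exact h0.comp_hasDerivAt (0 : ℝ) hl
  -- This uses `det (B + s C) = det B * det (1 + s B⁻¹ C)`.
  have h2 := (hasDerivAt_det_one_add_smul
    (((B.symm : E →L[ℝ] E) ∘L C : E →L[ℝ] E) : E →ₗ[ℝ] E)).const_mul (B : E →L[ℝ] E).det
  refine h1.unique (h2.congr_of_eventuallyEq (Eventually.of_forall fun s => ?_))
  simp only [ContinuousLinearMap.det]
  rw [← LinearMap.det_comp]
  congr 1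
  ext v
  simp

/-- The divergence of a vector field, multiplied by a density, is invariant under a change of
coordinates. -/
theorem trace_fderiv_piola {τ V W : E → E} {y₀ : E} {ε : ℝ}
    (hτ : ContDiffAt ℝ 2 τ y₀) (B : E ≃L[ℝ] E) (hB : fderiv ℝ τ y₀ = B)
    (hV : DifferentiableAt ℝ V y₀) (hW : DifferentiableAt ℝ W (τ y₀))
    (h : ∀ᶠ y in 𝓝 y₀, (ε * (fderiv ℝ τ y).det) • W (τ y) = fderiv ℝ τ y (V y)) :
    ε * (B : E →L[ℝ] E).det * LinearMap.trace ℝ E (fderiv ℝ W (τ y₀) : E →ₗ[ℝ] E) =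
      LinearMap.trace ℝ E (fderiv ℝ V y₀ : E →ₗ[ℝ] E) := by
  obtain ⟨D, hD, hDC⟩ := exists_hasFDerivAt_det B
  have hL : HasFDerivAt (fderiv ℝ τ) (fderiv ℝ (fderiv ℝ τ) y₀) y₀ :=
    ((hτ.fderiv_right (m := 1) (by norm_num)).differentiableAt (by norm_num)).hasFDerivAt
  set L' := fderiv ℝ (fderiv ℝ τ) y₀ with hL'
  have hsymm : ∀ u v, L' u v = L' v u := fun u v =>
    (hτ.isSymmSndFDerivAt (by simp)).eq u v
  have hτ1 : HasFDerivAt τ (B : E →L[ℝ] E) y₀ := hB ▸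
    (hτ.differentiableAt (by norm_num)).hasFDerivAt
  have hdet : HasFDerivAt (fun y => ε * (fderiv ℝ τ y).det) (ε • (D ∘L L')) y₀ := by
    rw [← hB] at hD
    exact (hD.comp y₀ hL).const_mul ε
  have hWτ := hW.hasFDerivAt.comp y₀ hτ1
  have e1 := hdet.smul hWτ
  have e2 := hL.clm_apply hV.hasFDerivAt
  -- Both sides of `h` are differentiated at `y₀`. After applying `B⁻¹` and taking the trace, the
  -- second derivatives of `τ` occur once through Jacobi's formula and once through `L' (V y₀)`;
  -- symmetry of `L'` and the value of `V y₀` make the two terms equal, so they cancel.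
  have e3 := (e1.congr_of_eventuallyEq (h.mono fun y hy => hy.symm)).unique e2
  have h0 := h.self_of_nhds
  rw [hB] at h0
  have hV0 : V y₀ = (ε * (B : E →L[ℝ] E).det) • B.symm (W (τ y₀)) := by
    rw [← map_smul, h0]; simp
  have e4 : (ε * (B : E →L[ℝ] E).det) •
        ((B.symm : E →ₗ[ℝ] E) ∘ₗ (fderiv ℝ W (τ y₀) : E →ₗ[ℝ] E) ∘ₗ (B : E →ₗ[ℝ] E)) +
      ((ε • (D ∘L L') : E →L[ℝ] ℝ) : E →ₗ[ℝ] ℝ).smulRight (B.symm (W (τ y₀))) =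
      (((B.symm : E →L[ℝ] E) ∘L (L' (V y₀)) : E →L[ℝ] E) : E →ₗ[ℝ] E) +
        (fderiv ℝ V y₀ : E →ₗ[ℝ] E) := by
    ext v
    have := congrArg B.symm (DFunLike.congr_fun e3 v)
    simp [hB] at this
    simp only [LinearMap.add_apply, smul_apply,
      LinearMap.smulRight_apply, ContinuousLinearMap.coe_coe, ContinuousLinearEquiv.coe_coe,
      ContinuousLinearMap.comp_apply, smul_eq_mul, hsymm (V y₀) v]
    exact this.trans (add_comm _ _)
  have e5 := congrArg (LinearMap.trace ℝ E) e4
  rw [map_add, map_add, map_smul, LinearMap.trace_smulRight, ← LinearMap.comp_assoc,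
    LinearMap.trace_comp_cycle', LinearMap.comp_assoc] at e5
  have e6 : (B : E →ₗ[ℝ] E) ∘ₗ (B.symm : E →ₗ[ℝ] E) ∘ₗ (fderiv ℝ W (τ y₀) : E →ₗ[ℝ] E) =
      (fderiv ℝ W (τ y₀) : E →ₗ[ℝ] E) := by
    ext v; simp
  have e7 : LinearMap.trace ℝ E ((B.symm : E →L[ℝ] E) ∘L (L' (V y₀)) : E →L[ℝ] E) =
      ε * D (L' (B.symm (W (τ y₀)))) := by
    rw [hDC, hV0, map_smul, ContinuousLinearMap.comp_smul]
    simp [mul_assoc]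
  rw [e7] at e5
  simp only [ContinuousLinearMap.coe_coe, ContinuousLinearMap.comp_apply,
    smul_apply, smul_eq_mul] at e5
  rw [e6] at e5
  linarith

end Calculus

/-! ### Divergence and integration by parts in Euclidean space. -/

section Divergence

variable {n : ℕ}

theorem sum_fderiv_apply_single {V : EuclideanSpace ℝ (Fin n) → EuclideanSpace ℝ (Fin n)}
    {y : EuclideanSpace ℝ (Fin n)} (hV : DifferentiableAt ℝ V y) :
    ∑ i : Fin n, fderiv ℝ (fun z => V z i) y (EuclideanSpace.single i (1 : ℝ)) =
      LinearMap.trace ℝ _ (fderiv ℝ V y : EuclideanSpace ℝ (Fin n) →ₗ[ℝ] _) := by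
  rw [LinearMap.trace_eq_matrix_trace ℝ (EuclideanSpace.basisFun (Fin n) ℝ).toBasis]
  simp only [Matrix.trace, Matrix.diag_apply, LinearMap.toMatrix_apply]
  refine Finset.sum_congr rfl fun i _ => ?_
  have h := ((EuclideanSpace.proj i : EuclideanSpace ℝ (Fin n) →L[ℝ] ℝ).hasFDerivAt.comp y
    hV.hasFDerivAt).fderiv
  have h' : fderiv ℝ (fun z => V z i) y =
      (EuclideanSpace.proj i : EuclideanSpace ℝ (Fin n) →L[ℝ] ℝ) ∘L fderiv ℝ V y := h
  rw [h']
  simp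

/-- Integration by parts against a compactly supported vector field. -/
theorem integral_fderiv_apply_eq_neg {U : Set (EuclideanSpace ℝ (Fin n))} (hU : IsOpen U)
    {H : EuclideanSpace ℝ (Fin n) → ℝ} {V : EuclideanSpace ℝ (Fin n) → EuclideanSpace ℝ (Fin n)}
    (hH : ContDiffOn ℝ 1 H U) (hV : ContDiff ℝ 1 V) (hVc : HasCompactSupport V)
    (hVU : tsupport V ⊆ U) :
    ∫ y, fderiv ℝ H y (V y) =
      -∫ y, H y * ∑ i : Fin n, fderiv ℝ (fun z => V z i) y (EuclideanSpace.single i (1 : ℝ)) := by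
  set e : Fin n → EuclideanSpace ℝ (Fin n) := fun i => EuclideanSpace.single i (1 : ℝ) with he
  have hcomp : ∀ i, ContDiff ℝ 1 (fun z => V z i) := fun i =>
    (EuclideanSpace.proj i : EuclideanSpace ℝ (Fin n) →L[ℝ] ℝ).contDiff.comp hV
  have hsub : ∀ i, tsupport (fun z => V z i) ⊆ tsupport V := fun i =>
    closure_mono fun z hz hz0 => hz (by simp [hz0])
  have hci : ∀ i, HasCompactSupport (fun z => V z i) := fun i =>
    hVc.mono' ((subset_tsupport _).trans (hsub i))
  have hHd : ContinuousOn (fderiv ℝ H) U :=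
    hH.continuousOn_fderiv_of_isOpen hU (by norm_num)
  -- `f` is only controlled on `U`, but `p` vanishes off a compact subset of `U`, so the product is
  -- continuous everywhere.
  have hcont : ∀ {f p : EuclideanSpace ℝ (Fin n) → ℝ}, ContinuousOn f U → Continuous p →
      HasCompactSupport p → tsupport p ⊆ U → Integrable (fun y => f y * p y) := by
    intro f p hf hp hpc hpU
    have hcc : Continuous (fun y => f y * p y) := by
      rw [continuous_iff_continuousAt]
      intro y
      by_cases hy : y ∈ tsupport p
      · exact (hf.continuousAt (hU.mem_nhds (hpU hy))).mul hp.continuousAt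
      · have : (fun y => f y * p y) =ᶠ[𝓝 y] fun _ => 0 := by
          filter_upwards [(isClosed_tsupport p).isOpen_compl.mem_nhds hy] with z hz
          rw [image_eq_zero_of_notMem_tsupport hz, mul_zero]
        exact continuousAt_const.congr this.symm
    exact hcc.integrable_of_hasCompactSupport hpc.mul_left
  have hfe : ∀ i, ContinuousOn (fun y => fderiv ℝ H y (e i)) U := fun i =>
    hHd.clm_apply continuousOn_const
  have hI1 : ∀ i, Integrable (fun y => fderiv ℝ H y (e i) * V y i) := fun i =>
    hcont (hfe i) (hcomp i).continuous (hci i) ((hsub i).trans hVU)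
  have hI2 : ∀ i, Integrable (fun y => H y * fderiv ℝ (fun z => V z i) y (e i)) := fun i =>
    hcont hH.continuousOn (((hcomp i).continuous_fderiv (by norm_num)).clm_apply continuous_const)
      ((hci i).fderiv_apply ℝ (e i))
      ((tsupport_fderiv_apply_subset ℝ (e i)).trans ((hsub i).trans hVU))
  have hI3 : ∀ i, Integrable (fun y => H y * V y i) := fun i =>
    hcont hH.continuousOn (hcomp i).continuous (hci i) ((hsub i).trans hVU)
  have key : ∀ i, ∫ y, H y * fderiv ℝ (fun z => V z i) y (e i) =
      -∫ y, fderiv ℝ H y (e i) * V y i := fun i =>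
    integral_mul_fderiv_eq_neg_fderiv_mul_of_integrable (hI1 i) (hI2 i) (hI3 i)
      (fun x hx => (hH.contDiffAt (hU.mem_nhds (hVU (hsub i hx)))).differentiableAt (by norm_num))
      (fun x _ => (hcomp i).differentiable (by norm_num) x)
  have hsum : ∀ y, fderiv ℝ H y (V y) = ∑ i, fderiv ℝ H y (e i) * V y i := by
    intro y
    have h1 : V y = ∑ i, V y i • e i := by
      simpa using ((EuclideanSpace.basisFun (Fin n) ℝ).sum_repr (V y)).symm
    conv_lhs => rw [h1]
    simp [mul_comm]
  simp_rw [hsum, Finset.mul_sum]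
  rw [integral_finsetSum _ fun i _ => hI1 i, integral_finsetSum _ fun i _ => hI2 i,
    ← Finset.sum_neg_distrib]
  exact Finset.sum_congr rfl fun i _ => by rw [key i, neg_neg]

end Divergence

variable {n : ℕ} {N : Type*} [TopologicalSpace N] [ChartedSpace (EuclideanSpace ℝ (Fin n)) N]
  [IsManifold (𝓡 n) ∞ N]

/-! ### Charts and changes of coordinates. -/

section Chart

theorem isOpen_chartTarget (c : N) : IsOpen (extChartAt (𝓡 n) c).target :=
  isOpen_extChartAt_target c

theorem contMDiffAt_chart {c x : N} (hx : x ∈ (extChartAt (𝓡 n) c).source) :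
    ContMDiffAt (𝓡 n) (𝓡 n) ∞ (extChartAt (𝓡 n) c) x :=
  contMDiffAt_extChartAt' (by rwa [← extChartAt_source (𝓡 n)])

theorem contMDiffAt_chart_symm {c : N} {y : EuclideanSpace ℝ (Fin n)}
    (hy : y ∈ (extChartAt (𝓡 n) c).target) :
    ContMDiffAt (𝓡 n) (𝓡 n) ∞ (extChartAt (𝓡 n) c).symm y :=
  (contMDiffOn_extChartAt_symm c).contMDiffAt ((isOpen_chartTarget c).mem_nhds hy)

theorem mdifferentiableAt_chart {c x : N} (hx : x ∈ (extChartAt (𝓡 n) c).source) :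
    MDifferentiableAt (𝓡 n) (𝓡 n) (extChartAt (𝓡 n) c) x :=
  (contMDiffAt_chart hx).mdifferentiableAt (by simp)

theorem mdifferentiableAt_chart_symm {c : N} {y : EuclideanSpace ℝ (Fin n)}
    (hy : y ∈ (extChartAt (𝓡 n) c).target) :
    MDifferentiableAt (𝓡 n) (𝓡 n) (extChartAt (𝓡 n) c).symm y :=
  (contMDiffAt_chart_symm hy).mdifferentiableAt (by simp)

theorem mfderiv_chart_symm_apply {c : N} {y : EuclideanSpace ℝ (Fin n)}
    (hy : y ∈ (extChartAt (𝓡 n) c).target) (v : EuclideanSpace ℝ (Fin n)) :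
    mfderiv (𝓡 n) (𝓡 n) (extChartAt (𝓡 n) c) ((extChartAt (𝓡 n) c).symm y)
      (mfderiv (𝓡 n) (𝓡 n) (extChartAt (𝓡 n) c).symm y v) = v := by
  have h := mfderiv_extChartAt_comp_mfderivWithin_extChartAt_symm (I := 𝓡 n) hy
  rw [(𝓡 n).range_eq_univ, mfderivWithin_univ] at h
  exact DFunLike.congr_fun h v

theorem mfderiv_symm_chart_apply {c : N} {y : EuclideanSpace ℝ (Fin n)}
    (hy : y ∈ (extChartAt (𝓡 n) c).target)
    (v : TangentSpace (𝓡 n) ((extChartAt (𝓡 n) c).symm y)) :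
    mfderiv (𝓡 n) (𝓡 n) (extChartAt (𝓡 n) c).symm y
      (mfderiv (𝓡 n) (𝓡 n) (extChartAt (𝓡 n) c) ((extChartAt (𝓡 n) c).symm y) v) = v := by
  have h := mfderivWithin_extChartAt_symm_comp_mfderiv_extChartAt (I := 𝓡 n) hy
  rw [(𝓡 n).range_eq_univ, mfderivWithin_univ] at h
  exact DFunLike.congr_fun h v

/-- The change of coordinates from the chart centred at `c` to the chart centred at `d`. -/
def transition (c d : N) (y : EuclideanSpace ℝ (Fin n)) : EuclideanSpace ℝ (Fin n) :=
  extChartAt (𝓡 n) d ((extChartAt (𝓡 n) c).symm y)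

theorem contDiffAt_transition {c d : N} {y : EuclideanSpace ℝ (Fin n)}
    (hy : y ∈ (extChartAt (𝓡 n) c).target)
    (hd : (extChartAt (𝓡 n) c).symm y ∈ (extChartAt (𝓡 n) d).source) :
    ContDiffAt ℝ ∞ (transition c d) y :=
  ((contMDiffAt_chart hd).comp y (contMDiffAt_chart_symm hy)).contDiffAt

theorem fderiv_transition_apply {c d : N} {y : EuclideanSpace ℝ (Fin n)}
    (hy : y ∈ (extChartAt (𝓡 n) c).target)
    (hd : (extChartAt (𝓡 n) c).symm y ∈ (extChartAt (𝓡 n) d).source)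
    (v : EuclideanSpace ℝ (Fin n)) :
    fderiv ℝ (transition c d) y v =
      mfderiv (𝓡 n) (𝓡 n) (extChartAt (𝓡 n) d) ((extChartAt (𝓡 n) c).symm y)
        (mfderiv (𝓡 n) (𝓡 n) (extChartAt (𝓡 n) c).symm y v) := by
  have h := mfderiv_comp y (mdifferentiableAt_chart hd) (mdifferentiableAt_chart_symm hy)
  rw [mfderiv_eq_fderiv] at h
  exact DFunLike.congr_fun h v

theorem transition_symm {c d : N} {y : EuclideanSpace ℝ (Fin n)}
    (hd : (extChartAt (𝓡 n) c).symm y ∈ (extChartAt (𝓡 n) d).source) :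
    (extChartAt (𝓡 n) d).symm (transition c d y) = (extChartAt (𝓡 n) c).symm y :=
  (extChartAt (𝓡 n) d).left_inv hd

theorem transition_mem_target {c d : N} {y : EuclideanSpace ℝ (Fin n)}
    (hd : (extChartAt (𝓡 n) c).symm y ∈ (extChartAt (𝓡 n) d).source) :
    transition c d y ∈ (extChartAt (𝓡 n) d).target :=
  (extChartAt (𝓡 n) d).map_source hd

theorem fderiv_transition_comp {c d : N} {y : EuclideanSpace ℝ (Fin n)}
    (hy : y ∈ (extChartAt (𝓡 n) c).target)
    (hd : (extChartAt (𝓡 n) c).symm y ∈ (extChartAt (𝓡 n) d).source)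
    (v : EuclideanSpace ℝ (Fin n)) :
    fderiv ℝ (transition d c) (transition c d y) (fderiv ℝ (transition c d) y v) = v := by
  have hc : (extChartAt (𝓡 n) d).symm (transition c d y) ∈ (extChartAt (𝓡 n) c).source := by
    rw [transition_symm hd]
    exact (extChartAt (𝓡 n) c).map_target hy
  have hnear : ∀ᶠ z in 𝓝 y, transition d c (transition c d z) = z := by
    have h1 := (mdifferentiableAt_chart_symm hy).continuousAt.preimage_mem_nhds
      ((isOpen_extChartAt_source (I := 𝓡 n) d).mem_nhds hd)
    filter_upwards [h1, (isOpen_chartTarget c).mem_nhds hy] with z hz hzc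
    rw [transition, transition_symm hz, (extChartAt (𝓡 n) c).right_inv hzc]
  have h1 := (((contDiffAt_transition (transition_mem_target hd) hc).differentiableAt
    (by simp)).hasFDerivAt.comp y
    ((contDiffAt_transition hy hd).differentiableAt (by simp)).hasFDerivAt)
  have h2 := h1.unique ((hasFDerivAt_id y).congr_of_eventuallyEq hnear)
  exact DFunLike.congr_fun h2 v

/-- The derivative of a change of coordinates, as a linear equivalence. -/
def transitionEquiv {c d : N} {y : EuclideanSpace ℝ (Fin n)}
    (hy : y ∈ (extChartAt (𝓡 n) c).target)
    (hd : (extChartAt (𝓡 n) c).symm y ∈ (extChartAt (𝓡 n) d).source) :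
    EuclideanSpace ℝ (Fin n) ≃L[ℝ] EuclideanSpace ℝ (Fin n) :=
  ContinuousLinearEquiv.equivOfInverse (fderiv ℝ (transition c d) y)
    (fderiv ℝ (transition d c) (transition c d y)) (fderiv_transition_comp hy hd) (by
      have hc : (extChartAt (𝓡 n) d).symm (transition c d y) ∈ (extChartAt (𝓡 n) c).source := by
        rw [transition_symm hd]
        exact (extChartAt (𝓡 n) c).map_target hy
      have hcy : transition d c (transition c d y) = y := by
        rw [transition, transition_symm hd, (extChartAt (𝓡 n) c).right_inv hy]
      intro v
      have := fderiv_transition_comp (transition_mem_target hd) hc v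
      rwa [hcy] at this)

theorem coe_transitionEquiv {c d : N} {y : EuclideanSpace ℝ (Fin n)}
    (hy : y ∈ (extChartAt (𝓡 n) c).target)
    (hd : (extChartAt (𝓡 n) c).symm y ∈ (extChartAt (𝓡 n) d).source) :
    (transitionEquiv hy hd : EuclideanSpace ℝ (Fin n) →L[ℝ] EuclideanSpace ℝ (Fin n)) =
      fderiv ℝ (transition c d) y := rfl

theorem components_transition {c d : N} {y : EuclideanSpace ℝ (Fin n)}
    (X : ∀ x : N, TangentSpace (𝓡 n) x) (hy : y ∈ (extChartAt (𝓡 n) c).target)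
    (hd : (extChartAt (𝓡 n) c).symm y ∈ (extChartAt (𝓡 n) d).source) :
    components d X (transition c d y) = fderiv ℝ (transition c d) y (components c X y) := by
  rw [fderiv_transition_apply hy hd, components, components, mfderiv_symm_chart_apply hy,
    transition_symm hd]

end Chart

/-! ### The metric and its volume density in coordinates. -/

section Gram

/-- The metric in the coordinates of the chart centred at `c`. -/
def gramForm (g : Metric n N) (c : N) (y : EuclideanSpace ℝ (Fin n)) :
    LinearMap.BilinForm ℝ (EuclideanSpace ℝ (Fin n)) :=
  show LinearMap.BilinForm ℝ (TangentSpace (𝓡 n) y) from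
  LinearMap.mk₂ ℝ (fun v w : TangentSpace (𝓡 n) y => g.inner ((extChartAt (𝓡 n) c).symm y)
      (mfderiv (𝓡 n) (𝓡 n) (extChartAt (𝓡 n) c).symm y v)
      (mfderiv (𝓡 n) (𝓡 n) (extChartAt (𝓡 n) c).symm y w))
    (fun _ _ _ => by rw [map_add, map_add]; rfl) (fun _ _ _ => by rw [map_smul, map_smul]; rfl)
    (fun _ _ _ => by rw [map_add, map_add]) (fun _ _ _ => by rw [map_smul, map_smul])

theorem gramForm_apply (g : Metric n N) (c : N) (y v w : EuclideanSpace ℝ (Fin n)) :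
    gramForm g c y v w = g.inner ((extChartAt (𝓡 n) c).symm y)
      (mfderiv (𝓡 n) (𝓡 n) (extChartAt (𝓡 n) c).symm y v)
      (mfderiv (𝓡 n) (𝓡 n) (extChartAt (𝓡 n) c).symm y w) := rfl

theorem gramForm_components (g : Metric n N) {c x : N} (hx : x ∈ (extChartAt (𝓡 n) c).source)
    (X Y : ∀ x : N, TangentSpace (𝓡 n) x) :
    gramForm g c (extChartAt (𝓡 n) c x) (components c X (extChartAt (𝓡 n) c x))
      (components c Y (extChartAt (𝓡 n) c x)) = g.inner x (X x) (Y x) := by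
  have hy := (extChartAt (𝓡 n) c).map_source hx
  rw [gramForm_apply, components, components, mfderiv_symm_chart_apply hy,
    mfderiv_symm_chart_apply hy, (extChartAt (𝓡 n) c).left_inv hx]

end Gram

section GramProperties

theorem gramForm_symm (g : Metric n N) (c : N) (y v w : EuclideanSpace ℝ (Fin n)) :
    gramForm g c y v w = gramForm g c y w v := g.symm _ _ _

theorem gramForm_pos (g : Metric n N) {c : N} {y v : EuclideanSpace ℝ (Fin n)}
    (hy : y ∈ (extChartAt (𝓡 n) c).target) (hv : v ≠ 0) : 0 < gramForm g c y v v := by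
  refine g.pos _ _ fun h => hv ?_
  have h1 := mfderiv_chart_symm_apply hy v
  rw [h] at h1
  exact h1.symm.trans (map_zero _)

theorem gramForm_transition (g : Metric n N) {c d : N} {y : EuclideanSpace ℝ (Fin n)}
    (hy : y ∈ (extChartAt (𝓡 n) c).target)
    (hd : (extChartAt (𝓡 n) c).symm y ∈ (extChartAt (𝓡 n) d).source)
    (v w : EuclideanSpace ℝ (Fin n)) :
    gramForm g c y v w = gramForm g d (transition c d y) (fderiv ℝ (transition c d) y v)
      (fderiv ℝ (transition c d) y w) := by
  have key : ∀ (x : N) (p q : TangentSpace (𝓡 n) x) (hx : x ∈ (extChartAt (𝓡 n) d).source),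
      g.inner x p q = gramForm g d (extChartAt (𝓡 n) d x)
        (mfderiv (𝓡 n) (𝓡 n) (extChartAt (𝓡 n) d) x p)
        (mfderiv (𝓡 n) (𝓡 n) (extChartAt (𝓡 n) d) x q) := by
    intro x p q hx
    obtain ⟨z, hz, rfl⟩ : ∃ z ∈ (extChartAt (𝓡 n) d).target, (extChartAt (𝓡 n) d).symm z = x :=
      ⟨_, (extChartAt (𝓡 n) d).map_source hx, (extChartAt (𝓡 n) d).left_inv hx⟩
    -- The base point of the tangent space depends on the coordinate point, so the equality of
    -- coordinates is substituted for a free `z'` instead of being rewritten.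
    have aux : ∀ z' : EuclideanSpace ℝ (Fin n), z' = z →
        g.inner ((extChartAt (𝓡 n) d).symm z) p q = gramForm g d z'
          (mfderiv (𝓡 n) (𝓡 n) (extChartAt (𝓡 n) d) ((extChartAt (𝓡 n) d).symm z) p)
          (mfderiv (𝓡 n) (𝓡 n) (extChartAt (𝓡 n) d) ((extChartAt (𝓡 n) d).symm z) q) := by
      rintro _ rfl
      exact congrArg₂ (fun a b => g.inner _ a b) (mfderiv_symm_chart_apply hz p).symm
        (mfderiv_symm_chart_apply hz q).symm
    exact aux _ ((extChartAt (𝓡 n) d).right_inv hz)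
  rw [gramForm_apply, key _ _ _ hd, fderiv_transition_apply hy hd, fderiv_transition_apply hy hd]
  rfl

/-- The tangent map of the inverse chart is applied to the constant section `v`. The total-space
form is what lets the smoothness of `g` be evaluated on coordinate fields. -/
theorem contMDiffAt_mfderiv_chart_symm {c : N} {y : EuclideanSpace ℝ (Fin n)}
    (hy : y ∈ (extChartAt (𝓡 n) c).target) (v : EuclideanSpace ℝ (Fin n)) :
    ContMDiffAt (𝓡 n) ((𝓡 n).prod 𝓘(ℝ, EuclideanSpace ℝ (Fin n))) ∞
      (fun z => Bundle.TotalSpace.mk' (EuclideanSpace ℝ (Fin n))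
        (E := fun x : N => TangentSpace (𝓡 n) x) ((extChartAt (𝓡 n) c).symm z)
        (mfderiv (𝓡 n) (𝓡 n) (extChartAt (𝓡 n) c).symm z v)) y := by
  have hT := isOpen_chartTarget (n := n) c
  have h1 := (contMDiffOn_extChartAt_symm (I := 𝓡 n) (n := ∞) c).contMDiffOn_tangentMapWithin
    (m := ∞) (by simp) hT.uniqueMDiffOn
  have h2 : ContMDiff (𝓡 n) ((𝓡 n).tangent) ∞
      (fun z : EuclideanSpace ℝ (Fin n) => (⟨z, v⟩ : TangentBundle (𝓡 n) _)) :=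
    contMDiff_vectorSpace_iff_contDiff.2 contDiff_const
  have h3 : ContMDiffOn (𝓡 n) ((𝓡 n).tangent) ∞ (fun z : EuclideanSpace ℝ (Fin n) =>
      tangentMapWithin (𝓡 n) (𝓡 n) (extChartAt (𝓡 n) c).symm (extChartAt (𝓡 n) c).target ⟨z, v⟩)
      (extChartAt (𝓡 n) c).target :=
    h1.comp h2.contMDiffOn fun z hz => hz
  refine (h3.contMDiffAt (hT.mem_nhds hy)).congr_of_eventuallyEq ?_
  filter_upwards [hT.mem_nhds hy] with z hz
  rw [tangentMapWithin, mfderivWithin_of_isOpen hT hz]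

theorem contDiffAt_gramForm (g : Metric n N) {c : N} {y : EuclideanSpace ℝ (Fin n)}
    (hy : y ∈ (extChartAt (𝓡 n) c).target) (v w : EuclideanSpace ℝ (Fin n)) :
    ContDiffAt ℝ ∞ (fun z => gramForm g c z v w) y := by
  have h1 := contMDiffAt_mfderiv_chart_symm hy v
  have h2 := contMDiffAt_mfderiv_chart_symm hy w
  have h3 := (g.contMDiff ((extChartAt (𝓡 n) c).symm y)).comp y (contMDiffAt_chart_symm hy)
  have h4 := ContMDiffAt.clm_bundle_apply₂ (E₃ := Bundle.Trivial N ℝ) (F₃ := ℝ) h3 h1 h2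
  have h5 := (Bundle.contMDiffAt_totalSpace.1 h4).2
  exact h5.contDiffAt

theorem volDensity_eq (g : Metric n N) (c : N) (y : EuclideanSpace ℝ (Fin n)) :
    volDensity g c y = √(LinearMap.BilinForm.toMatrix
      (EuclideanSpace.basisFun (Fin n) ℝ).toBasis (gramForm g c y)).det := by
  rw [volDensity]
  congr 2

theorem det_gram_pos (g : Metric n N) {c : N} {y : EuclideanSpace ℝ (Fin n)}
    (hy : y ∈ (extChartAt (𝓡 n) c).target) :
    0 < (LinearMap.BilinForm.toMatrix
      (EuclideanSpace.basisFun (Fin n) ℝ).toBasis (gramForm g c y)).det := by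
  refine Matrix.PosDef.det_pos ((LinearMap.BilinForm.posDef_toQuadraticMap_iff_matrix _ _
    ⟨fun v w => gramForm_symm g c y v w⟩).1 fun v hv => ?_)
  exact gramForm_pos g hy hv

theorem volDensity_pos (g : Metric n N) {c : N} {y : EuclideanSpace ℝ (Fin n)}
    (hy : y ∈ (extChartAt (𝓡 n) c).target) : 0 < volDensity g c y := by
  rw [volDensity_eq]
  exact Real.sqrt_pos.2 (det_gram_pos g hy)

theorem contDiffAt_volDensity (g : Metric n N) {c : N} {y : EuclideanSpace ℝ (Fin n)}
    (hy : y ∈ (extChartAt (𝓡 n) c).target) : ContDiffAt ℝ ∞ (volDensity g c) y := by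
  rw [funext (volDensity_eq g c)]
  refine ContDiffAt.sqrt ?_ (det_gram_pos g hy).ne'
  simp only [Matrix.det_apply', LinearMap.BilinForm.toMatrix_apply]
  exact ContDiffAt.sum fun σ _ => contDiffAt_const.mul
    (contDiffAt_prod fun i _ => contDiffAt_gramForm g hy _ _)

/-- The Gram matrix changes by congruence with the Jacobian matrix, so its determinant gains the
square of the Jacobian determinant. -/
theorem volDensity_transition (g : Metric n N) {c d : N} {y : EuclideanSpace ℝ (Fin n)}
    (hy : y ∈ (extChartAt (𝓡 n) c).target)
    (hd : (extChartAt (𝓡 n) c).symm y ∈ (extChartAt (𝓡 n) d).source) :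
    volDensity g c y =
      |(fderiv ℝ (transition c d) y).det| * volDensity g d (transition c d y) := by
  set L := fderiv ℝ (transition c d) y
  have h : gramForm g c y = (gramForm g d (transition c d y)).comp L L := by
    ext v w
    exact gramForm_transition g hy hd v w
  rw [volDensity_eq, volDensity_eq, h,
    LinearMap.BilinForm.toMatrix_comp (EuclideanSpace.basisFun (Fin n) ℝ).toBasis
      (EuclideanSpace.basisFun (Fin n) ℝ).toBasis,
    Matrix.det_mul, Matrix.det_mul, Matrix.det_transpose, LinearMap.det_toMatrix,
    ContinuousLinearMap.det, ← Real.sqrt_sq_eq_abs, ← Real.sqrt_mul (sq_nonneg _)]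
  congr 1
  ring

end GramProperties

/-! ### The Riemannian volume measure. -/

section Volume

variable [MeasurableSpace N] [BorelSpace N]

theorem aemeasurable_chart_symm (g : Metric n N) (c : N) :
    AEMeasurable (extChartAt (𝓡 n) c).symm
      ((volume.restrict (extChartAt (𝓡 n) c).target).withDensity
        fun y => ENNReal.ofReal (volDensity g c y)) :=
  ((continuousOn_extChartAt_symm (I := 𝓡 n) c).aemeasurable
    (isOpen_chartTarget c).measurableSet).mono_ac (withDensity_absolutelyContinuous _ _)

theorem chartVolume_apply (g : Metric n N) (c : N) {s : Set N} (hs : MeasurableSet s) :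
    chartVolume g c s =
      ∫⁻ y in (extChartAt (𝓡 n) c).symm ⁻¹' s ∩ (extChartAt (𝓡 n) c).target,
        ENNReal.ofReal (volDensity g c y) := by
  rw [chartVolume, Measure.map_apply_of_aemeasurable (aemeasurable_chart_symm g c) hs,
    withDensity_apply', Measure.restrict_restrict' (isOpen_chartTarget c).measurableSet]

theorem measurableSet_preimage_chart_symm (c : N) {s : Set N} (hs : MeasurableSet s) :
    MeasurableSet ((extChartAt (𝓡 n) c).symm ⁻¹' s ∩ (extChartAt (𝓡 n) c).target) := by
  have hT := (isOpen_chartTarget (n := n) c).measurableSet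
  have h := (continuousOn_iff_continuous_domRestrict.1
    (continuousOn_extChartAt_symm (I := 𝓡 n) c)).measurable hs
  have h2 := (MeasurableEmbedding.subtype_coe hT).measurableSet_image.2 h
  convert h2 using 1
  ext y
  simp [and_comm]

theorem chartVolume_compl_source (g : Metric n N) (c : N) :
    chartVolume g c (extChartAt (𝓡 n) c).sourceᶜ = 0 := by
  rw [chartVolume_apply g c (isOpen_extChartAt_source c).measurableSet.compl]
  have : (extChartAt (𝓡 n) c).symm ⁻¹' (extChartAt (𝓡 n) c).sourceᶜ ∩
      (extChartAt (𝓡 n) c).target = ∅ := by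
    ext y
    simp only [mem_inter_iff, mem_preimage, mem_compl_iff, mem_empty_iff_false, iff_false,
      not_and]
    exact fun h hy => h ((extChartAt (𝓡 n) c).map_target hy)
  rw [this]
  simp

/-- This is the change of variables formula along the transition map, whose Jacobian is exactly the
ratio of the two densities. -/
theorem chartVolume_overlap (g : Metric n N) (c d : N) {s : Set N} (hs : MeasurableSet s)
    (hc : s ⊆ (extChartAt (𝓡 n) c).source) (hd : s ⊆ (extChartAt (𝓡 n) d).source) :
    chartVolume g c s = chartVolume g d s := by
  rw [chartVolume_apply g c hs, chartVolume_apply g d hs]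
  set S := (extChartAt (𝓡 n) c).symm ⁻¹' s ∩ (extChartAt (𝓡 n) c).target with hS
  have himg : (extChartAt (𝓡 n) d).symm ⁻¹' s ∩ (extChartAt (𝓡 n) d).target =
      transition c d '' S := by
    ext z
    constructor
    · rintro ⟨hz, hzT⟩
      refine ⟨transition d c z, ⟨?_, transition_mem_target (hc hz)⟩, ?_⟩
      · rw [mem_preimage, transition_symm (hc hz)]
        exact hz
      · rw [transition, transition_symm (hc hz), (extChartAt (𝓡 n) d).right_inv hzT]
    · rintro ⟨y, ⟨hy, hyT⟩, rfl⟩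
      refine ⟨?_, transition_mem_target (hd hy)⟩
      rw [mem_preimage, transition_symm (hd hy)]
      exact hy
  have hinj : InjOn (transition c d) S := by
    rintro y ⟨hy, hyT⟩ z ⟨hz, hzT⟩ h
    have := congrArg (extChartAt (𝓡 n) d).symm h
    rw [transition_symm (hd hy), transition_symm (hd hz)] at this
    exact (extChartAt (𝓡 n) c).symm.injOn hyT hzT this
  have hSm : MeasurableSet S := measurableSet_preimage_chart_symm c hs
  rw [himg, lintegral_image_eq_lintegral_abs_det_fderiv_mul volume hSm
    (fun y hy => ((contDiffAt_transition hy.2 (hd hy.1)).differentiableAt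
      (by simp)).hasFDerivAt.hasFDerivWithinAt) hinj]
  refine setLIntegral_congr_fun hSm fun y hy => ?_
  rw [volDensity_transition g hy.2 (hd hy.1), ENNReal.ofReal_mul (abs_nonneg _)]

theorem vol_restrict_source (g : Metric n N) (c : N) :
    (vol g).restrict (extChartAt (𝓡 n) c).source = chartVolume g c := by
  have hS := (isOpen_extChartAt_source (I := 𝓡 n) c).measurableSet
  have hself : (chartVolume g c).restrict (extChartAt (𝓡 n) c).source = chartVolume g c :=
    Measure.restrict_eq_self_of_ae_mem (by
      rw [ae_iff]; exact chartVolume_compl_source g c)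
  apply le_antisymm
  -- A supremum of measures is not computed set by set. It is bounded instead by one measure that
  -- dominates every chart volume: `chartVolume g c` on the chart domain and the trivial bound `⊤`
  -- off it.
  · have h1 : vol g ≤ chartVolume g c +
        (⊤ : Measure N).restrict (extChartAt (𝓡 n) c).sourceᶜ := by
      refine iSup_le fun d => ?_
      rw [← Measure.restrict_add_restrict_compl (μ := chartVolume g d) hS]
      refine add_le_add ?_ (Measure.restrict_mono subset_rfl le_top)
      refine Measure.le_iff.2 fun s hs => ?_
      rw [Measure.restrict_apply hs, ← measure_inter_add_sdiff _
        (isOpen_extChartAt_source (I := 𝓡 n) d).measurableSet]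
      have h0 : chartVolume g d ((s ∩ (extChartAt (𝓡 n) c).source) \
          (extChartAt (𝓡 n) d).source) = 0 :=
        measure_mono_null (fun x hx => hx.2) (chartVolume_compl_source g d)
      rw [h0, add_zero, ← chartVolume_overlap g c d
        ((hs.inter hS).inter (isOpen_extChartAt_source (I := 𝓡 n) d).measurableSet)
        (fun x hx => hx.1.2) (fun x hx => hx.2)]
      exact measure_mono fun x hx => hx.1.1
    refine (Measure.restrict_mono subset_rfl h1).trans ?_
    rw [Measure.restrict_add, hself, Measure.restrict_restrict hS]
    simp
  · conv_lhs => rw [← hself]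
    exact Measure.restrict_mono subset_rfl (le_iSup (chartVolume g) c)

theorem vol_apply_of_subset (g : Metric n N) (c : N) {s : Set N} (hs : MeasurableSet s)
    (hc : s ⊆ (extChartAt (𝓡 n) c).source) :
    vol g s = ∫⁻ y in (extChartAt (𝓡 n) c).symm ⁻¹' s ∩ (extChartAt (𝓡 n) c).target,
        ENNReal.ofReal (volDensity g c y) := by
  rw [← chartVolume_apply g c hs, ← vol_restrict_source, Measure.restrict_apply hs,
    inter_eq_left.2 hc]

instance isLocallyFiniteMeasure_vol (g : Metric n N) : IsLocallyFiniteMeasure (vol g) := by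
  refine ⟨fun x => ?_⟩
  set y := extChartAt (𝓡 n) x x
  have hy : y ∈ (extChartAt (𝓡 n) x).target := mem_extChartAt_target x
  have hev : ∀ᶠ z in 𝓝 y, volDensity g x z < volDensity g x y + 1 :=
    (contDiffAt_volDensity g hy).continuousAt.eventually_lt_const (by linarith)
  obtain ⟨r, hr, hball⟩ := Metric.eventually_nhds_iff_ball.1 hev
  set U := (extChartAt (𝓡 n) x).source ∩ extChartAt (𝓡 n) x ⁻¹' Metric.ball y r
  have hUo : IsOpen U := (continuousOn_extChartAt (I := 𝓡 n) x).isOpen_inter_preimage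
    (isOpen_extChartAt_source x) Metric.isOpen_ball
  refine ⟨U, hUo.mem_nhds ⟨mem_extChartAt_source x, Metric.mem_ball_self hr⟩, ?_⟩
  rw [vol_apply_of_subset g x hUo.measurableSet inter_subset_left]
  have hsub : (extChartAt (𝓡 n) x).symm ⁻¹' U ∩ (extChartAt (𝓡 n) x).target ⊆
      Metric.ball y r := by
    rintro z ⟨hz, hzT⟩
    have := hz.2
    rwa [mem_preimage, (extChartAt (𝓡 n) x).right_inv hzT] at this
  calc _ ≤ ∫⁻ _ in (extChartAt (𝓡 n) x).symm ⁻¹' U ∩ (extChartAt (𝓡 n) x).target,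
        ENNReal.ofReal (volDensity g x y + 1) :=
      setLIntegral_mono measurable_const fun z hz =>
        ENNReal.ofReal_le_ofReal (hball z (hsub hz)).le
    _ ≤ ∫⁻ _ in Metric.ball y r, ENNReal.ofReal (volDensity g x y + 1) :=
      lintegral_mono_set hsub
    _ < ⊤ := by
      rw [setLIntegral_const]
      exact ENNReal.mul_lt_top ENNReal.ofReal_lt_top measure_ball_lt_top

instance isOpenPosMeasure_vol (g : Metric n N) : (vol g).IsOpenPosMeasure := by
  refine ⟨fun U hU ⟨x, hx⟩ h0 => ?_⟩
  set V := (extChartAt (𝓡 n) x).source ∩ U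
  have hV : IsOpen V := (isOpen_extChartAt_source x).inter hU
  have h1 : vol g V = 0 := measure_mono_null inter_subset_right h0
  rw [vol_apply_of_subset g x hV.measurableSet inter_subset_left] at h1
  set W := (extChartAt (𝓡 n) x).symm ⁻¹' V ∩ (extChartAt (𝓡 n) x).target
  have hW : IsOpen W := by
    have := (continuousOn_extChartAt_symm (I := 𝓡 n) x).isOpen_inter_preimage
      (isOpen_chartTarget x) hV
    rwa [inter_comm] at this
  have hxW : extChartAt (𝓡 n) x x ∈ W := by
    refine ⟨?_, mem_extChartAt_target x⟩
    rw [mem_preimage, extChartAt_to_inv]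
    exact ⟨mem_extChartAt_source x, hx⟩
  have hm : AEMeasurable (fun y => ENNReal.ofReal (volDensity g x y)) (volume.restrict W) :=
    (ContinuousOn.aemeasurable (fun y hy =>
      (contDiffAt_volDensity g hy.2).continuousAt.continuousWithinAt)
      hW.measurableSet).ennreal_ofReal
  rw [lintegral_eq_zero_iff' hm] at h1
  have hF : ∀ᵐ y ∂(volume.restrict W), False := by
    filter_upwards [h1, ae_restrict_mem hW.measurableSet] with y hy hyW
    exact (ENNReal.ofReal_pos.2 (volDensity_pos g hyW.2)).ne' hy
  rw [eventually_false_iff_eq_bot, ae_eq_bot, Measure.restrict_eq_zero] at hF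
  exact (hW.measure_pos volume ⟨_, hxW⟩).ne' hF

theorem setIntegral_source_vol (g : Metric n N) (c : N) {F : N → ℝ}
    (hF : AEStronglyMeasurable F (vol g)) :
    ∫ x in (extChartAt (𝓡 n) c).source, F x ∂(vol g) =
      ∫ y in (extChartAt (𝓡 n) c).target,
        volDensity g c y * F ((extChartAt (𝓡 n) c).symm y) := by
  have hF' : AEStronglyMeasurable F (chartVolume g c) := by
    rw [← vol_restrict_source]; exact hF.restrict
  have hm : AEMeasurable (fun y => Real.toNNReal (volDensity g c y))
      (volume.restrict (extChartAt (𝓡 n) c).target) :=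
    (ContinuousOn.aemeasurable (fun y hy =>
      (contDiffAt_volDensity g hy).continuousAt.continuousWithinAt)
      (isOpen_chartTarget c).measurableSet).real_toNNReal
  rw [vol_restrict_source, chartVolume, integral_map (aemeasurable_chart_symm g c) hF']
  have : (fun y => ENNReal.ofReal (volDensity g c y)) =
    fun y => ((Real.toNNReal (volDensity g c y) : NNReal) : ℝ≥0∞) := rfl
  rw [this, integral_withDensity_eq_integral_smul₀ hm]
  refine setIntegral_congr_fun (isOpen_chartTarget c).measurableSet fun y hy => ?_
  simp only [NNReal.smul_def, smul_eq_mul, Real.coe_toNNReal _ (volDensity_pos g hy).le]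

end Volume

/-! ### Paths and their Eulerian velocity. -/

section Path

/-- This eliminates the cast in `rightTranslate`: every point has the form `φ x`, and there the cast
is along a reflexive equality. -/
theorem rightTranslate_induction (φ : Diff n N) (h : ∀ x : N, TangentSpace (𝓡 n) (φ x))
    {P : ∀ y : N, TangentSpace (𝓡 n) y → Prop} (H : ∀ x, P (φ x) (h x)) (y : N) :
    P y (rightTranslate φ h y) := by
  have aux : ∀ y' (e : φ (φ.symm y) = y'), P y' (e ▸ h (φ.symm y)) := by
    rintro _ rfl
    exact H _
  exact aux y _

theorem rightTranslate_apply (φ : Diff n N) (h : ∀ x : N, TangentSpace (𝓡 n) (φ x)) (x : N) :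
    rightTranslate φ h (φ x) = h x := by
  have := rightTranslate_induction φ h
    -- Quantifying over all preimages `z` of `y` makes the motive meaningful at every point;
    -- injectivity identifies `z` with the given one.
    (P := fun y v => ∀ z, (hz : φ z = y) → v = hz ▸ h z) (fun z w hw => by
      obtain rfl := φ.injective hw
      rfl) (φ x) x rfl
  exact this

variable {S : Set (Diff n N)} {φ₀ φ₁ : Diff n N} {φ : ℝ → Diff n N}

/-- The Eulerian velocity field `∂ₜφ ∘ φ⁻¹` of a path. -/
def eulerian (φ : ℝ → Diff n N) (t : ℝ) : ∀ x : N, TangentSpace (𝓡 n) x :=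
  rightTranslate (φ t) (velocity φ t)

theorem IsSmoothPath.contMDiffAt (hφ : IsSmoothPath S φ₀ φ₁ φ) {t : ℝ} (ht : t ∈ Ioo (0 : ℝ) 1)
    (x : N) : ContMDiffAt (𝓘(ℝ, ℝ).prod (𝓡 n)) (𝓡 n) ∞ (fun p : ℝ × N => φ p.1 p.2) (t, x) :=
  hφ.smooth.contMDiffAt (prod_mem_nhds (Icc_mem_nhds ht.1 ht.2) univ_mem)

theorem IsSmoothPath.contMDiffAt_time (hφ : IsSmoothPath S φ₀ φ₁ φ) {t : ℝ}
    (ht : t ∈ Ioo (0 : ℝ) 1) (x : N) :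
    ContMDiffAt 𝓘(ℝ, ℝ) (𝓡 n) ∞ (fun s => φ s x) t :=
  (hφ.contMDiffAt ht x).comp t (contMDiffAt_id.prodMk contMDiffAt_const)

theorem IsSmoothPath.mfderiv_velocity (hφ : IsSmoothPath S φ₀ φ₁ φ) {t : ℝ}
    (ht : t ∈ Ioo (0 : ℝ) 1) {F : Type*} [NormedAddCommGroup F] [NormedSpace ℝ F] {f : N → F}
    {x : N} (hf : MDifferentiableAt (𝓡 n) 𝓘(ℝ, F) f (φ t x)) :
    HasDerivAt (fun s => f (φ s x)) (mfderiv (𝓡 n) 𝓘(ℝ, F) f (φ t x) (velocity φ t x)) t := by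
  have h1 := (hφ.contMDiffAt_time ht x).mdifferentiableAt (by simp)
  have h2 := (hf.comp t h1).differentiableAt.hasDerivAt
  have h3 := mfderiv_comp t hf h1
  rw [mfderiv_eq_fderiv] at h3
  have h4 : deriv (f ∘ fun s => φ s x) t =
      mfderiv (𝓡 n) 𝓘(ℝ, F) f (φ t x) (velocity φ t x) := by
    rw [← fderiv_apply_one_eq_deriv, velocity,
      mfderivWithin_of_mem_nhds (Icc_mem_nhds ht.1 ht.2)]
    exact DFunLike.congr_fun h3 (1 : ℝ)
  rw [h4] at h2
  exact h2

theorem IsSmoothPath.contDiffAt_chart (hφ : IsSmoothPath S φ₀ φ₁ φ) {t : ℝ}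
    (ht : t ∈ Ioo (0 : ℝ) 1) {c : N} {x : N} {q : EuclideanSpace ℝ (Fin n) → N}
    {y : EuclideanSpace ℝ (Fin n)} (hq : ContMDiffAt (𝓡 n) (𝓡 n) ∞ q y) (hqx : q y = x)
    (hx : φ t x ∈ (extChartAt (𝓡 n) c).source) :
    ContDiffAt ℝ ∞ (fun p : ℝ × EuclideanSpace ℝ (Fin n) =>
      extChartAt (𝓡 n) c (φ p.1 (q p.2))) (t, y) := by
  subst hqx
  have h1 : ContMDiffAt 𝓘(ℝ, ℝ × EuclideanSpace ℝ (Fin n)) (𝓘(ℝ, ℝ).prod (𝓡 n)) ∞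
      (fun p : ℝ × EuclideanSpace ℝ (Fin n) => (p.1, q p.2)) (t, y) :=
    contDiff_fst.contMDiff.contMDiffAt.prodMk
      (ContMDiffAt.comp (t, y) hq contDiff_snd.contMDiff.contMDiffAt)
  have h2 := ContMDiffAt.comp (t, y) (hφ.contMDiffAt ht (q y)) h1
  exact (ContMDiffAt.comp (t, y) (contMDiffAt_chart hx) h2).contDiffAt

/-- Freezing the label `(φ t)⁻¹` at time `t` exhibits the components as a partial time derivative of
a jointly smooth map, from which their smoothness in `y` follows. -/
theorem IsSmoothPath.components_eulerian (hφ : IsSmoothPath S φ₀ φ₁ φ) {t : ℝ}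
    (ht : t ∈ Ioo (0 : ℝ) 1) {c : N} {y : EuclideanSpace ℝ (Fin n)}
    (hy : y ∈ (extChartAt (𝓡 n) c).target) :
    HasDerivAt (fun s => extChartAt (𝓡 n) c (φ s ((φ t).symm ((extChartAt (𝓡 n) c).symm y))))
      (components c (eulerian φ t) y) t := by
  rw [components]
  exact rightTranslate_induction (φ t) (velocity φ t)
    (P := fun x v => x ∈ (extChartAt (𝓡 n) c).source →
      HasDerivAt (fun s => extChartAt (𝓡 n) c (φ s ((φ t).symm x)))
        (mfderiv (𝓡 n) (𝓡 n) (extChartAt (𝓡 n) c) x v) t) (fun x hx => by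
      rw [(φ t).symm_apply_apply]
      exact hφ.mfderiv_velocity ht (mdifferentiableAt_chart hx)) _
    ((extChartAt (𝓡 n) c).map_target hy)

theorem IsSmoothPath.contDiffAt_components (hφ : IsSmoothPath S φ₀ φ₁ φ) {t : ℝ}
    (ht : t ∈ Ioo (0 : ℝ) 1) {c : N} {y : EuclideanSpace ℝ (Fin n)}
    (hy : y ∈ (extChartAt (𝓡 n) c).target) :
    ContDiffAt ℝ ∞ (components c (eulerian φ t)) y := by
  set F : ℝ × EuclideanSpace ℝ (Fin n) → EuclideanSpace ℝ (Fin n) := fun p =>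
    extChartAt (𝓡 n) c (φ p.1 ((φ t).symm ((extChartAt (𝓡 n) c).symm p.2))) with hF
  have hFs : ∀ z ∈ (extChartAt (𝓡 n) c).target, ContDiffAt ℝ ∞ F (t, z) := fun z hz =>
    hφ.contDiffAt_chart ht (q := fun z => (φ t).symm ((extChartAt (𝓡 n) c).symm z))
      (ContMDiffAt.comp z ((φ t).symm.contMDiff _) (contMDiffAt_chart_symm hz)) rfl (by
        rw [(φ t).apply_symm_apply]; exact (extChartAt (𝓡 n) c).map_target hz)
  have hcomp : ∀ z ∈ (extChartAt (𝓡 n) c).target,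
      components c (eulerian φ t) z = fderiv ℝ F (t, z) (1, 0) := fun z hz => by
    have h1 := ((hFs z hz).differentiableAt (by simp)).hasFDerivAt.comp_hasDerivAt t
      ((hasDerivAt_id t).prodMk (hasDerivAt_const t z))
    exact (hφ.components_eulerian ht hz).unique h1
  have h2 : ContDiffAt ℝ ∞ (fun z => fderiv ℝ F (t, z) (1, 0)) y :=
    (((hFs y hy).fderiv_right (m := ∞) (by simp)).comp y
      (contDiffAt_const.prodMk contDiffAt_id)).clm_apply contDiffAt_const
  exact h2.congr_of_eventuallyEq
    (eventually_of_mem ((isOpen_chartTarget c).mem_nhds hy) hcomp)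

end Path

/-! ### Regularity of the inverse flow and the transport equation. -/

section Inverse

variable {S : Set (Diff n N)} {φ₀ φ₁ : Diff n N} {φ : ℝ → Diff n N}

/-- The block triangular equivalence `(τ, w) ↦ (τ, τ • l + A w)`. -/
def shearEquiv {E : Type*} [NormedAddCommGroup E] [NormedSpace ℝ E] (A : E ≃L[ℝ] E) (l : E) :
    (ℝ × E) ≃L[ℝ] (ℝ × E) :=
  ContinuousLinearEquiv.equivOfInverse
    ((ContinuousLinearMap.fst ℝ ℝ E).prod
      ((ContinuousLinearMap.fst ℝ ℝ E).smulRight l + (A : E →L[ℝ] E) ∘L .snd ℝ ℝ E))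
    ((ContinuousLinearMap.fst ℝ ℝ E).prod ((A.symm : E →L[ℝ] E) ∘L
      (.snd ℝ ℝ E - (ContinuousLinearMap.fst ℝ ℝ E).smulRight l)))
    (fun p => by ext <;> simp) (fun p => by ext <;> simp)

/-- A diffeomorphism, in charts, has an invertible derivative. -/
theorem exists_equiv_fderiv_chart (ψ : Diff n N) {c d : N} {v : EuclideanSpace ℝ (Fin n)}
    (hv : v ∈ (extChartAt (𝓡 n) d).target)
    (hc : ψ ((extChartAt (𝓡 n) d).symm v) ∈ (extChartAt (𝓡 n) c).source) :
    ∃ A : EuclideanSpace ℝ (Fin n) ≃L[ℝ] EuclideanSpace ℝ (Fin n),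
      HasFDerivAt (fun w => extChartAt (𝓡 n) c (ψ ((extChartAt (𝓡 n) d).symm w)))
        (A : EuclideanSpace ℝ (Fin n) →L[ℝ] EuclideanSpace ℝ (Fin n)) v := by
  have hi1 := isInvertible_mfderivWithin_extChartAt_symm (I := 𝓡 n) hv
  rw [(𝓡 n).range_eq_univ, mfderivWithin_univ] at hi1
  have hi2 := isInvertible_mfderiv_extChartAt (I := 𝓡 n) hc
  obtain ⟨A1, hA1⟩ := hi1
  obtain ⟨A2, hA2⟩ := hi2
  let A3 := ψ.mfderivToContinuousLinearEquiv (by simp) ((extChartAt (𝓡 n) d).symm v)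
  have h1 := (mdifferentiableAt_chart_symm hv).hasMFDerivAt
  have h3 := ((ψ.contMDiff ((extChartAt (𝓡 n) d).symm v)).mdifferentiableAt (by simp)).hasMFDerivAt
  have h2 := (mdifferentiableAt_chart hc).hasMFDerivAt
  have h4 := (h2.comp v (h3.comp v h1)).hasFDerivAt
  refine ⟨(A1.trans (A3.trans A2)), ?_⟩
  convert h4 using 1
  rw [← hA1, ← hA2]
  rfl

/-- The inverse function theorem is applied to `(s, w) ↦ (s, φ s w)` in charts. Its derivative is
block triangular with invertible diagonal, and injectivity of each `φ s` identifies the local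
inverse with `(φ s).symm`. -/
theorem IsSmoothPath.contMDiffAt_symm (hφ : IsSmoothPath S φ₀ φ₁ φ) {t : ℝ}
    (ht : t ∈ Ioo (0 : ℝ) 1) {c : N} {y : EuclideanSpace ℝ (Fin n)}
    (hy : y ∈ (extChartAt (𝓡 n) c).target) :
    ContMDiffAt 𝓘(ℝ, ℝ × EuclideanSpace ℝ (Fin n)) (𝓡 n) ∞
      (fun p : ℝ × EuclideanSpace ℝ (Fin n) => (φ p.1).symm ((extChartAt (𝓡 n) c).symm p.2))
      (t, y) := by
  set x₀ := (φ t).symm ((extChartAt (𝓡 n) c).symm y) with hx₀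
  set v₀ := extChartAt (𝓡 n) x₀ x₀ with hv₀
  have hv₀T : v₀ ∈ (extChartAt (𝓡 n) x₀).target := mem_extChartAt_target x₀
  have hvx : (extChartAt (𝓡 n) x₀).symm v₀ = x₀ := extChartAt_to_inv x₀
  have hφx : φ t x₀ = (extChartAt (𝓡 n) c).symm y := (φ t).apply_symm_apply _
  have hsrc : φ t x₀ ∈ (extChartAt (𝓡 n) c).source := by
    rw [hφx]; exact (extChartAt (𝓡 n) c).map_target hy
  set F : ℝ × EuclideanSpace ℝ (Fin n) → EuclideanSpace ℝ (Fin n) := fun p =>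
    extChartAt (𝓡 n) c (φ p.1 ((extChartAt (𝓡 n) x₀).symm p.2)) with hF
  have hFs : ContDiffAt ℝ ∞ F (t, v₀) :=
    hφ.contDiffAt_chart ht (contMDiffAt_chart_symm hv₀T) hvx hsrc
  have hF0 : F (t, v₀) = y := by
    simp only [hF, hvx, hφx, (extChartAt (𝓡 n) c).right_inv hy]
  obtain ⟨A, hA⟩ := exists_equiv_fderiv_chart (φ t) (c := c) hv₀T (by rwa [hvx])
  have hFd := (hFs.differentiableAt (by simp)).hasFDerivAt
  have hFA : ∀ w, fderiv ℝ F (t, v₀) (0, w) = A w := fun w => by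
    have h1 := hFd.comp v₀ ((hasFDerivAt_const t v₀).prodMk (hasFDerivAt_id v₀))
    exact (DFunLike.congr_fun (hA.unique h1) w).symm
  set P : ℝ × EuclideanSpace ℝ (Fin n) → ℝ × EuclideanSpace ℝ (Fin n) := fun p =>
    (p.1, F p) with hP
  have hPs : ContDiffAt ℝ ∞ P (t, v₀) := contDiffAt_fst.prodMk hFs
  set B := shearEquiv A (fderiv ℝ F (t, v₀) (1, 0)) with hB
  have hPB : HasFDerivAt P (B : ℝ × EuclideanSpace ℝ (Fin n) →L[ℝ] _) (t, v₀) := by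
    have h1 : HasFDerivAt P ((ContinuousLinearMap.fst ℝ ℝ (EuclideanSpace ℝ (Fin n))).prod
        (fderiv ℝ F (t, v₀))) (t, v₀) := hasFDerivAt_fst.prodMk hFd
    convert h1 using 1
    refine ContinuousLinearMap.ext fun p => ?_
    have h2 : p = p.1 • ((1, 0) : ℝ × EuclideanSpace ℝ (Fin n)) + (0, p.2) := by ext <;> simp
    have h3 : fderiv ℝ F (t, v₀) p = p.1 • fderiv ℝ F (t, v₀) (1, 0) + A p.2 := by
      conv_lhs => rw [h2]
      rw [map_add, map_smul, hFA]
    rw [ContinuousLinearMap.prod_apply, h3]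
    rfl
  set e := hPs.toOpenPartialHomeomorph P hPB (by simp) with he
  have hsrc_e : (t, v₀) ∈ e.source := hPs.mem_toOpenPartialHomeomorph_source hPB (by simp)
  have hPt : P (t, v₀) = (t, y) := by rw [hP]; simp only [hF0]
  have htgt : (t, y) ∈ e.target := by
    rw [← hPt]; exact hPs.image_mem_toOpenPartialHomeomorph_target hPB (by simp)
  have hQs : ContDiffAt ℝ ∞ e.symm (t, y) := by
    rw [← hPt]; exact hPs.to_localInverse hPB (by simp)
  have hQ0 : e.symm (t, y) = (t, v₀) := by
    rw [← hPt]; exact e.left_inv hsrc_e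
  have hM : ContMDiffAt 𝓘(ℝ, ℝ × EuclideanSpace ℝ (Fin n)) (𝓡 n) ∞
      (fun p => (extChartAt (𝓡 n) x₀).symm (e.symm p).2) (t, y) := by
    have h1 : ContMDiffAt (𝓡 n) (𝓡 n) ∞ (extChartAt (𝓡 n) x₀).symm (e.symm (t, y)).2 := by
      rw [hQ0]; exact contMDiffAt_chart_symm hv₀T
    exact ContMDiffAt.comp (t, y) h1 (contDiffAt_snd.comp (t, y) hQs).contMDiffAt
  refine hM.congr_of_eventuallyEq ?_
  have hcont : ContinuousAt (fun p : ℝ × EuclideanSpace ℝ (Fin n) =>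
      φ p.1 ((extChartAt (𝓡 n) x₀).symm (e.symm p).2)) (t, y) := by
    have h1 : ContinuousAt (fun p : ℝ × N => φ p.1 p.2)
        (t, (extChartAt (𝓡 n) x₀).symm (e.symm (t, y)).2) := (hφ.contMDiffAt ht _).continuousAt
    exact ContinuousAt.comp (f := fun p : ℝ × EuclideanSpace ℝ (Fin n) =>
      (p.1, (extChartAt (𝓡 n) x₀).symm (e.symm p).2)) h1
      (continuousAt_fst.prodMk hM.continuousAt)
  have hnear : ∀ᶠ p in 𝓝 (t, y), φ p.1 ((extChartAt (𝓡 n) x₀).symm (e.symm p).2) ∈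
      (extChartAt (𝓡 n) c).source := by
    apply hcont.eventually_mem
    apply (isOpen_extChartAt_source (I := 𝓡 n) c).mem_nhds
    simpa only [hQ0, hvx] using hsrc
  filter_upwards [hnear, e.open_target.mem_nhds htgt,
    (continuous_snd.continuousAt.preimage_mem_nhds ((isOpen_chartTarget c).mem_nhds hy) :
      Prod.snd ⁻¹' (extChartAt (𝓡 n) c).target ∈ 𝓝 (t, y))] with p hp hpe hpT
  have h1 : P (e.symm p) = p := e.right_inv hpe
  have h2 : (e.symm p).1 = p.1 := (congrArg Prod.fst h1 : (P (e.symm p)).1 = p.1)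
  have h3 : F (e.symm p) = p.2 := (congrArg Prod.snd h1 : (P (e.symm p)).2 = p.2)
  simp only [hF, h2] at h3
  have h4 : φ p.1 ((extChartAt (𝓡 n) x₀).symm (e.symm p).2) = (extChartAt (𝓡 n) c).symm p.2 := by
    rw [← h3, (extChartAt (𝓡 n) c).left_inv hp]
  rw [← h4, (φ p.1).symm_apply_apply]

theorem IsSmoothPath.contDiffAt_transport (hφ : IsSmoothPath S φ₀ φ₁ φ) {f : N → ℝ}
    (hf : ContMDiff (𝓡 n) 𝓘(ℝ, ℝ) ∞ f) {t : ℝ} (ht : t ∈ Ioo (0 : ℝ) 1) {c : N}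
    {y : EuclideanSpace ℝ (Fin n)} (hy : y ∈ (extChartAt (𝓡 n) c).target) :
    ContDiffAt ℝ ∞ (fun p : ℝ × EuclideanSpace ℝ (Fin n) =>
      f ((φ p.1).symm ((extChartAt (𝓡 n) c).symm p.2))) (t, y) :=
  (ContMDiffAt.comp (t, y) (hf _) (hφ.contMDiffAt_symm ht hy)).contDiffAt

/-- The transport equation `∂ₜ(f ∘ φ⁻¹) + d(f ∘ φ⁻¹)(X) = 0`, in coordinates. -/
theorem IsSmoothPath.transport_eq (hφ : IsSmoothPath S φ₀ φ₁ φ) {f : N → ℝ}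
    (hf : ContMDiff (𝓡 n) 𝓘(ℝ, ℝ) ∞ f) {t : ℝ} (ht : t ∈ Ioo (0 : ℝ) 1) {c : N}
    {y : EuclideanSpace ℝ (Fin n)} (hy : y ∈ (extChartAt (𝓡 n) c).target) :
    fderiv ℝ (fun p : ℝ × EuclideanSpace ℝ (Fin n) =>
      f ((φ p.1).symm ((extChartAt (𝓡 n) c).symm p.2))) (t, y)
      (1, components c (eulerian φ t) y) = 0 := by
  set H : ℝ × EuclideanSpace ℝ (Fin n) → ℝ := fun p =>
    f ((φ p.1).symm ((extChartAt (𝓡 n) c).symm p.2)) with hH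
  set x := (φ t).symm ((extChartAt (𝓡 n) c).symm y) with hx
  have hφx : φ t x = (extChartAt (𝓡 n) c).symm y := (φ t).apply_symm_apply _
  have hk := hφ.components_eulerian ht hy
  have hcy : (t, extChartAt (𝓡 n) c (φ t x)) = (t, y) := by
    rw [hφx, (extChartAt (𝓡 n) c).right_inv hy]
  have hHd : HasFDerivAt H (fderiv ℝ H (t, y)) (t, extChartAt (𝓡 n) c (φ t x)) := by
    rw [hcy]
    exact ((hφ.contDiffAt_transport hf ht hy).differentiableAt (by simp)).hasFDerivAt
  have h1 := hHd.comp_hasDerivAt t ((hasDerivAt_id t).prodMk hk)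
  -- `f ∘ (φ s)⁻¹` is constant along the trajectory `s ↦ φ s x`; differentiating this gives the
  -- equation.
  have hconst : (H ∘ fun s => (s, extChartAt (𝓡 n) c (φ s x))) =ᶠ[𝓝 t] fun _ => f x := by
    have h2 : ∀ᶠ s in 𝓝 t, φ s x ∈ (extChartAt (𝓡 n) c).source := by
      apply (hφ.contMDiffAt_time ht x).continuousAt.eventually_mem
      apply (isOpen_extChartAt_source (I := 𝓡 n) c).mem_nhds
      rw [hφx]; exact (extChartAt (𝓡 n) c).map_target hy
    filter_upwards [h2] with s hs
    simp only [hH, Function.comp_apply, (extChartAt (𝓡 n) c).left_inv hs,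
      (φ s).symm_apply_apply]
  exact h1.unique ((hasDerivAt_const t (f x)).congr_of_eventuallyEq hconst)

/-- The inverse function theorem covers interior times only; compactness also reaches the end
points. The preimages of `y` stay in the compact set `insert y K`, and each of their cluster points
as `s → t` is mapped to `y` by `φ t`, hence is unique. -/
theorem IsSmoothPath.continuousOn_symm [T2Space N] (hφ : IsSmoothPath S φ₀ φ₁ φ) (y : N) :
    ContinuousOn (fun t => (φ t).symm y) (Icc (0 : ℝ) 1) := by
  obtain ⟨K, hK, hKφ⟩ := hφ.compactSupport
  intro t ht
  have hmem : ∀ s ∈ Icc (0 : ℝ) 1, (φ s).symm y ∈ insert y K := fun s hs => by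
    by_contra h
    simp only [mem_insert_iff, not_or] at h
    have := hKφ s hs _ h.2
    rw [(φ s).apply_symm_apply] at this
    exact h.1 this.symm
  refine (hK.insert y).tendsto_nhds_of_unique_mapClusterPt
    (eventually_of_mem self_mem_nhdsWithin hmem) fun x _ hx => ?_
  have hc : ContinuousWithinAt (fun p : ℝ × N => φ p.1 p.2) (Icc (0 : ℝ) 1 ×ˢ univ) (t, x) :=
    (hφ.smooth (t, x) ⟨ht, mem_univ _⟩).continuousWithinAt
  by_contra hne
  have hxy : φ t x ≠ y := fun h => hne (by
    rw [← h]
    exact ((φ t).symm_apply_apply x).symm)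
  have hev := hc.eventually (isOpen_ne.mem_nhds hxy)
  rw [nhdsWithin_prod_eq, nhdsWithin_univ] at hev
  obtain ⟨A, hA, B, hB, hAB⟩ := mem_prod_iff.1 hev
  obtain ⟨s, hsB, hsA⟩ := ((hx.frequently hB).and_eventually hA).exists
  exact hAB (mk_mem_prod hsA hsB) ((φ s).apply_symm_apply y)

end Inverse

/-! ### Chart independence and continuity of the divergence. -/

section Divergence

/-- Vector fields with smooth components in all charts. -/
def IsSmoothField (X : ∀ x : N, TangentSpace (𝓡 n) x) : Prop :=
  ∀ c : N, ∀ y ∈ (extChartAt (𝓡 n) c).target, ContDiffAt ℝ ∞ (components c X) y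

/-- The divergence of a vector field, computed in the chart centred at `c`. -/
def chartDivergence (g : Metric n N) (c : N) (X : ∀ x : N, TangentSpace (𝓡 n) x)
    (y : EuclideanSpace ℝ (Fin n)) : ℝ :=
  (volDensity g c y)⁻¹ * ∑ i : Fin n, fderiv ℝ (fun z => volDensity g c z * components c X z i)
      y (EuclideanSpace.single i (1 : ℝ))

theorem chartDivergence_eq_trace (g : Metric n N) {X : ∀ x : N, TangentSpace (𝓡 n) x}
    (hX : IsSmoothField X) {c : N} {y : EuclideanSpace ℝ (Fin n)}
    (hy : y ∈ (extChartAt (𝓡 n) c).target) :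
    chartDivergence g c X y = (volDensity g c y)⁻¹ * LinearMap.trace ℝ _
      (fderiv ℝ (fun z => volDensity g c z • components c X z) y :
        EuclideanSpace ℝ (Fin n) →ₗ[ℝ] EuclideanSpace ℝ (Fin n)) := by
  rw [← sum_fderiv_apply_single (V := fun z => volDensity g c z • components c X z)
    (((contDiffAt_volDensity g hy).smul (hX c y hy)).differentiableAt (by simp))]
  rfl

/-- `divergence` uses a different chart at each point, so this invariance is needed before it can be
seen to be continuous or be integrated in a fixed chart. -/
theorem chartDivergence_transition (g : Metric n N) {X : ∀ x : N, TangentSpace (𝓡 n) x}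
    (hX : IsSmoothField X) {c d : N} {y : EuclideanSpace ℝ (Fin n)}
    (hy : y ∈ (extChartAt (𝓡 n) c).target)
    (hd : (extChartAt (𝓡 n) c).symm y ∈ (extChartAt (𝓡 n) d).source) :
    chartDivergence g c X y = chartDivergence g d X (transition c d y) := by
  have hτy := transition_mem_target hd
  rw [chartDivergence_eq_trace g hX hy, chartDivergence_eq_trace g hX hτy]
  set B := transitionEquiv hy hd with hB
  have hdet : (fderiv ℝ (transition c d) y).det ≠ 0 := by
    rw [← coe_transitionEquiv hy hd]
    exact (LinearEquiv.isUnit_det' B.toLinearEquiv).ne_zero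
  -- The sign of the Jacobian determinant is locally constant, so `|det|` equals `ε * det` near `y`,
  -- the form required by `trace_fderiv_piola`.
  set ε : ℝ := ((SignType.sign (fderiv ℝ (transition c d) y).det : SignType) : ℝ) with hε
  have hcont : ContinuousAt (fun z => (fderiv ℝ (transition c d) z).det) y :=
    ((contDiff_clm_det (m := 0)).continuous.continuousAt).comp
      ((contDiffAt_transition hy hd).fderiv_right (m := ∞) (by simp)).continuousAt
  have hsign : ∀ᶠ z in 𝓝 y, ε * (fderiv ℝ (transition c d) z).det =
      |(fderiv ℝ (transition c d) z).det| := by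
    rcases hdet.lt_or_gt with h | h
    · filter_upwards [hcont.eventually_lt_const h] with z hz
      rw [hε, sign_neg h, abs_of_neg hz]; simp
    · filter_upwards [hcont.eventually_const_lt h] with z hz
      rw [hε, sign_pos h, abs_of_pos hz]; simp
  have hsrc : ∀ᶠ z in 𝓝 y, (extChartAt (𝓡 n) c).symm z ∈ (extChartAt (𝓡 n) d).source :=
    (mdifferentiableAt_chart_symm hy).continuousAt.eventually_mem
      ((isOpen_extChartAt_source (I := 𝓡 n) d).mem_nhds hd)
  have hp := trace_fderiv_piola (τ := transition c d) (y₀ := y) (ε := ε)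
    (V := fun z => volDensity g c z • components c X z)
    (W := fun z => volDensity g d z • components d X z)
    ((contDiffAt_transition hy hd).of_le ENat.LEInfty.out) B
    (coe_transitionEquiv hy hd).symm
    (((contDiffAt_volDensity g hy).smul (hX c y hy)).differentiableAt (by simp))
    (((contDiffAt_volDensity g hτy).smul (hX d _ hτy)).differentiableAt (by simp)) (by
      filter_upwards [hsign, hsrc, (isOpen_chartTarget c).mem_nhds hy] with z hz hzd hzT
      rw [hz, map_smul, components_transition X hzT hzd, volDensity_transition g hzT hzd,
        smul_smul])
  rw [hB, coe_transitionEquiv hy hd, hsign.self_of_nhds] at hp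
  rw [← hp, volDensity_transition g hy hd]
  have h1 : |(fderiv ℝ (transition c d) y).det| ≠ 0 := abs_ne_zero.2 hdet
  have h2 := (volDensity_pos g hτy).ne'
  field_simp

theorem divergence_eq_chartDivergence (g : Metric n N) {X : ∀ x : N, TangentSpace (𝓡 n) x}
    (hX : IsSmoothField X) {c x : N} (hx : x ∈ (extChartAt (𝓡 n) c).source) :
    divergence g X x = chartDivergence g c X (extChartAt (𝓡 n) c x) := by
  have hd : (extChartAt (𝓡 n) c).symm (extChartAt (𝓡 n) c x) ∈ (extChartAt (𝓡 n) x).source := by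
    rw [(extChartAt (𝓡 n) c).left_inv hx]; exact mem_extChartAt_source x
  rw [chartDivergence_transition g hX ((extChartAt (𝓡 n) c).map_source hx) hd, transition,
    (extChartAt (𝓡 n) c).left_inv hx]
  rfl

theorem contDiffAt_chartDivergence (g : Metric n N) {X : ∀ x : N, TangentSpace (𝓡 n) x}
    (hX : IsSmoothField X) {c : N} {y : EuclideanSpace ℝ (Fin n)}
    (hy : y ∈ (extChartAt (𝓡 n) c).target) : ContDiffAt ℝ ∞ (chartDivergence g c X) y := by
  refine ((contDiffAt_volDensity g hy).inv (volDensity_pos g hy).ne').mul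
    (ContDiffAt.sum fun i _ => ?_)
  have h1 : ContDiffAt ℝ ∞ (fun z => volDensity g c z * components c X z i) y :=
    (contDiffAt_volDensity g hy).mul
      ((EuclideanSpace.proj i : EuclideanSpace ℝ (Fin n) →L[ℝ] ℝ).contDiff.contDiffAt.comp y
        (hX c y hy))
  exact (h1.fderiv_right (m := ∞) (by simp)).clm_apply contDiffAt_const

theorem continuous_divergence (g : Metric n N) {X : ∀ x : N, TangentSpace (𝓡 n) x}
    (hX : IsSmoothField X) : Continuous (divergence g X) := by
  rw [continuous_iff_continuousAt]
  intro x
  have h1 : ContinuousAt (fun z => chartDivergence g x X (extChartAt (𝓡 n) x z)) x :=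
    ContinuousAt.comp (g := chartDivergence g x X)
      (contDiffAt_chartDivergence g hX (mem_extChartAt_target x)).continuousAt
      (continuousAt_extChartAt x)
  refine h1.congr ?_
  filter_upwards [(isOpen_extChartAt_source (I := 𝓡 n) x).mem_nhds (mem_extChartAt_source x)]
    with z hz
  exact (divergence_eq_chartDivergence g hX hz).symm

theorem gramForm_eq_sum (g : Metric n N) (c : N) (y v w : EuclideanSpace ℝ (Fin n)) :
    gramForm g c y v w = ∑ i, ∑ j, v i * w j * gramForm g c y (EuclideanSpace.single i (1 : ℝ))
      (EuclideanSpace.single j (1 : ℝ)) := by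
  have h : ∀ v : EuclideanSpace ℝ (Fin n), v = ∑ i, v i • EuclideanSpace.single i (1 : ℝ) := by
    intro v
    simpa using ((EuclideanSpace.basisFun (Fin n) ℝ).sum_repr v).symm
  conv_lhs => rw [h v, h w]
  simp only [map_sum, map_smul, LinearMap.sum_apply, LinearMap.smul_apply, smul_eq_mul,
    Finset.mul_sum]
  exact Finset.sum_comm.trans (Finset.sum_congr rfl fun i _ => Finset.sum_congr rfl fun j _ => by
    ring)

theorem continuous_inner (g : Metric n N) {X : ∀ x : N, TangentSpace (𝓡 n) x}
    (hX : IsSmoothField X) : Continuous (fun x => g.inner x (X x) (X x)) := by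
  rw [continuous_iff_continuousAt]
  intro x
  have hy := mem_extChartAt_target (I := 𝓡 n) x
  have h0 : ∀ i, ContinuousAt (fun z => components x X z i) (extChartAt (𝓡 n) x x) := fun i =>
    (EuclideanSpace.proj i : EuclideanSpace ℝ (Fin n) →L[ℝ] ℝ).continuous.continuousAt.comp
      (hX x _ hy).continuousAt
  have h1 : ContinuousAt (fun z => gramForm g x z (components x X z) (components x X z))
      (extChartAt (𝓡 n) x x) := by
    rw [funext fun z => gramForm_eq_sum g x z (components x X z) (components x X z)]
    exact tendsto_finsetSum _ fun i _ => tendsto_finsetSum _ fun j _ =>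
      ((h0 i).mul (h0 j)).mul (contDiffAt_gramForm g hy _ _).continuousAt
  have h2 := ContinuousAt.comp (f := extChartAt (𝓡 n) x) h1 (continuousAt_extChartAt x)
  refine h2.congr ?_
  filter_upwards [(isOpen_extChartAt_source (I := 𝓡 n) x).mem_nhds (mem_extChartAt_source x)]
    with z hz
  exact gramForm_components g hz X X

theorem inner_self_nonneg (g : Metric n N) (x : N) (v : TangentSpace (𝓡 n) x) :
    0 ≤ g.inner x v v := by
  by_cases h : v = 0
  · rw [h, map_zero]
  · exact (g.pos x v h).le

theorem divergence_eq_zero (g : Metric n N) {X : ∀ x : N, TangentSpace (𝓡 n) x} {U : Set N}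
    (hU : IsOpen U) (hX : ∀ x ∈ U, X x = 0) {x : N} (hx : x ∈ U) : divergence g X x = 0 := by
  have hev : ∀ᶠ z in 𝓝 (extChartAt (𝓡 n) x x), components x X z = 0 := by
    have h1 : ContinuousAt (extChartAt (𝓡 n) x).symm (extChartAt (𝓡 n) x x) :=
      continuousAt_extChartAt_symm x
    have h2 := h1.eventually_mem (hU.mem_nhds (by rwa [extChartAt_to_inv]))
    filter_upwards [h2] with z hz
    rw [components, hX _ hz, map_zero]
    rfl
  rw [divergence]
  refine mul_eq_zero_of_right _ (Finset.sum_eq_zero fun i _ => ?_)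
  have h3 : (fun z => volDensity g x z * components x X z i) =ᶠ[𝓝 (extChartAt (𝓡 n) x x)]
      fun _ => 0 := by
    filter_upwards [hev] with z hz
    simp [hz]
  rw [h3.fderiv_eq]
  simp

end Divergence

/-! ### Smoothness and support of the Eulerian field. -/

section EulerianField

variable {S : Set (Diff n N)} {φ₀ φ₁ : Diff n N} {φ : ℝ → Diff n N}

theorem IsSmoothPath.isSmoothField (hφ : IsSmoothPath S φ₀ φ₁ φ) {t : ℝ}
    (ht : t ∈ Ioo (0 : ℝ) 1) : IsSmoothField (eulerian φ t) :=
  fun _ _ hy => hφ.contDiffAt_components ht hy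

theorem IsSmoothPath.exists_compact_eulerian_eq_zero (hφ : IsSmoothPath S φ₀ φ₁ φ) :
    ∃ K : Set N, IsCompact K ∧ ∀ t ∈ Ioo (0 : ℝ) 1, ∀ x ∉ K, eulerian φ t x = 0 := by
  obtain ⟨K, hK, hKφ⟩ := hφ.compactSupport
  refine ⟨K, hK, fun t ht x hx => ?_⟩
  have htI : t ∈ Icc (0 : ℝ) 1 := ⟨ht.1.le, ht.2.le⟩
  refine rightTranslate_induction (φ t) (velocity φ t) (P := fun y v => y ∉ K → v = 0)
    (fun z hz => ?_) x hx
  -- The point `φ t z` lies off `K`, so `φ t` fixes it, and injectivity gives `φ t z = z`.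
  have hzK : z ∉ K := by
    have : φ t z = z := (φ t).injective (hKφ t htI _ hz)
    rwa [this] at hz
  have hev : (fun s => φ s z) =ᶠ[𝓝 t] fun _ => z := by
    filter_upwards [Icc_mem_nhds ht.1 ht.2] with s hs using hKφ s hs z hzK
  rw [velocity, mfderivWithin_of_mem_nhds (Icc_mem_nhds ht.1 ht.2), hev.mfderiv_eq,
    mfderiv_const]
  rfl

end EulerianField

/-! ### Cauchy–Schwarz and bounds on directional derivatives. -/

section Estimates

theorem setIntegral_abs_le {α : Type*} [MeasurableSpace α] {μ : Measure α} {K : Set α}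
    (hK : MeasurableSet K) (hμK : μ K ≠ ⊤) {u : α → ℝ} (hu : MemLp u 2 μ) :
    ∫ x in K, |u x| ∂μ ≤ √(μ.real K) * √(∫ x, u x ^ 2 ∂μ) := by
  have h := integral_mul_le_Lp_mul_Lq_of_nonneg (μ := μ) Real.HolderConjugate.two_two
    (f := K.indicator fun _ => (1 : ℝ)) (g := fun x => |u x|)
    (Eventually.of_forall fun x => indicator_nonneg (fun _ _ => zero_le_one) x)
    (Eventually.of_forall fun x => abs_nonneg _)
    (by simpa using memLp_indicator_const 2 hK (1 : ℝ) (Or.inr hμK)) (by simpa [Pi.abs_def] using hu.abs)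
  have h1 : ∫ x, K.indicator (fun _ => (1 : ℝ)) x * |u x| ∂μ = ∫ x in K, |u x| ∂μ := by
    rw [← integral_indicator hK]
    congr 1; ext x
    by_cases hx : x ∈ K <;> simp [hx]
  have h2 : ∫ x, K.indicator (fun _ => (1 : ℝ)) x ^ (2 : ℝ) ∂μ = μ.real K := by
    rw [← integral_indicator_one hK]
    congr 1; ext x
    by_cases hx : x ∈ K <;> simp [hx]
  rw [h1, h2, ← Real.sqrt_eq_rpow, ← Real.sqrt_eq_rpow] at h
  simpa using h

/-- The derivative of a function in the direction of a vector field. -/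
def dirDeriv (ρ : N → ℝ) (X : ∀ x : N, TangentSpace (𝓡 n) x) (x : N) : ℝ :=
  mfderiv (𝓡 n) 𝓘(ℝ, ℝ) ρ x (X x)

theorem dirDeriv_eq_fderiv_components {ρ : N → ℝ} (hρ : ContMDiff (𝓡 n) 𝓘(ℝ, ℝ) ∞ ρ) {c : N}
    {y : EuclideanSpace ℝ (Fin n)} (hy : y ∈ (extChartAt (𝓡 n) c).target)
    (X : ∀ x : N, TangentSpace (𝓡 n) x) :
    dirDeriv ρ X ((extChartAt (𝓡 n) c).symm y) =
      fderiv ℝ (fun z => ρ ((extChartAt (𝓡 n) c).symm z)) y (components c X y) := by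
  have h := mfderiv_comp y ((hρ ((extChartAt (𝓡 n) c).symm y)).mdifferentiableAt (by simp))
    (mdifferentiableAt_chart_symm hy)
  rw [mfderiv_eq_fderiv] at h
  have h2 := DFunLike.congr_fun h (components c X y)
  have h3 : mfderiv (𝓡 n) (𝓡 n) (extChartAt (𝓡 n) c).symm y (components c X y) =
      X ((extChartAt (𝓡 n) c).symm y) := mfderiv_symm_chart_apply hy _
  have h4 := congrArg (mfderiv (𝓡 n) 𝓘(ℝ, ℝ) ρ ((extChartAt (𝓡 n) c).symm y)) h3
  exact (h2.trans h4).symm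

/-- On a compact part of a chart the metric dominates a multiple of the Euclidean norm. -/
theorem exists_pos_mul_norm_sq_le_gramForm (g : Metric n N) (c : N)
    {Q : Set (EuclideanSpace ℝ (Fin n))} (hQ : IsCompact Q)
    (hQT : Q ⊆ (extChartAt (𝓡 n) c).target) :
    ∃ m : ℝ, 0 < m ∧ ∀ y ∈ Q, ∀ v, m * ‖v‖ ^ 2 ≤ gramForm g c y v v := by
  have hcont : ContinuousOn (fun p : EuclideanSpace ℝ (Fin n) × EuclideanSpace ℝ (Fin n) =>
      gramForm g c p.1 p.2 p.2) (Q ×ˢ Metric.sphere 0 1) := by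
    rw [funext fun p : EuclideanSpace ℝ (Fin n) × EuclideanSpace ℝ (Fin n) =>
      gramForm_eq_sum g c p.1 p.2 p.2]
    refine continuousOn_finsetSum _ fun i _ => continuousOn_finsetSum _ fun j _ => ?_
    have hp : ∀ i : Fin n, Continuous
        (fun p : EuclideanSpace ℝ (Fin n) × EuclideanSpace ℝ (Fin n) => p.2 i) := fun i =>
      (EuclideanSpace.proj i : EuclideanSpace ℝ (Fin n) →L[ℝ] ℝ).continuous.comp continuous_snd
    refine ((hp i).mul (hp j)).continuousOn.mul fun p hp => ?_
    exact (ContinuousAt.comp (f := Prod.fst)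
      (contDiffAt_gramForm g (hQT hp.1) _ _).continuousAt continuousAt_fst).continuousWithinAt
  -- The form has a positive lower bound on the compact set `Q × sphere`; the general vector follows
  -- by homogeneity.
  obtain ⟨m, hm, hmle⟩ := (hQ.prod (isCompact_sphere 0 1)).exists_forall_le' hcont (a := 0)
    (fun p hp => gramForm_pos g (hQT hp.1) (ne_zero_of_mem_unit_sphere ⟨p.2, hp.2⟩))
  refine ⟨m, hm, fun y hy v => ?_⟩
  by_cases hv : v = 0
  · simp [hv]
  have hv' : ‖v‖ ≠ 0 := norm_ne_zero_iff.2 hv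
  have h1 := hmle (y, ‖v‖⁻¹ • v) ⟨hy, by simp [norm_smul, hv']⟩
  simp only [map_smul, LinearMap.smul_apply, smul_eq_mul] at h1
  calc m * ‖v‖ ^ 2 ≤ (‖v‖⁻¹ * (‖v‖⁻¹ * gramForm g c y v v)) * ‖v‖ ^ 2 := by gcongr
    _ = gramForm g c y v v := by field_simp

/-- The point is the order of quantifiers: `C` is chosen before `X`, so one constant serves all
times of all paths. -/
theorem exists_abs_dirDeriv_le (g : Metric n N) {ρ : N → ℝ}
    (hρ : ContMDiff (𝓡 n) 𝓘(ℝ, ℝ) ∞ ρ) (hρc : HasCompactSupport ρ) {c : N}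
    (hρs : tsupport ρ ⊆ (extChartAt (𝓡 n) c).source) :
    ∃ C : ℝ, 0 ≤ C ∧ ∀ (X : ∀ x : N, TangentSpace (𝓡 n) x) (x : N),
      |dirDeriv ρ X x| ≤
        (tsupport ρ).indicator (fun x => C * √(g.inner x (X x) (X x))) x := by
  set Q := extChartAt (𝓡 n) c '' tsupport ρ with hQ
  have hQc : IsCompact Q := hρc.isCompact.image_of_continuousOn
    ((continuousOn_extChartAt (I := 𝓡 n) c).mono hρs)
  have hQT : Q ⊆ (extChartAt (𝓡 n) c).target := by
    rintro _ ⟨x, hx, rfl⟩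
    exact (extChartAt (𝓡 n) c).map_source (hρs hx)
  obtain ⟨m, hm, hmle⟩ := exists_pos_mul_norm_sq_le_gramForm g c hQc hQT
  have hsm : ∀ y ∈ Q, ContDiffAt ℝ ∞ (fun z => ρ ((extChartAt (𝓡 n) c).symm z)) y := fun y hy =>
    (ContMDiffAt.comp y (hρ _) (contMDiffAt_chart_symm (hQT hy))).contDiffAt
  obtain ⟨D, hD⟩ := hQc.exists_bound_of_continuousOn
    (f := fderiv ℝ (fun z => ρ ((extChartAt (𝓡 n) c).symm z)))
    (fun y hy => ((hsm y hy).fderiv_right (m := ∞) (by simp)).continuousAt.continuousWithinAt)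
  refine ⟨|D| / √m, by positivity, fun X x => ?_⟩
  by_cases hx : x ∈ tsupport ρ
  · rw [indicator_of_mem hx]
    have hxs := hρs hx
    have hyQ : extChartAt (𝓡 n) c x ∈ Q := mem_image_of_mem _ hx
    have h1 := dirDeriv_eq_fderiv_components hρ (hQT hyQ) X
    rw [(extChartAt (𝓡 n) c).left_inv hxs] at h1
    set v := components c X (extChartAt (𝓡 n) c x)
    have h2 := hmle _ hyQ v
    rw [gramForm_components g hxs X X] at h2
    have h3 : √m * ‖v‖ ≤ √(g.inner x (X x) (X x)) := by
      rw [← Real.sqrt_sq (norm_nonneg v), ← Real.sqrt_mul hm.le]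
      exact Real.sqrt_le_sqrt h2
    have h4 : ‖fderiv ℝ (fun z => ρ ((extChartAt (𝓡 n) c).symm z)) (extChartAt (𝓡 n) c x) v‖ ≤
        |D| * ‖v‖ := ContinuousLinearMap.le_of_opNorm_le _ ((hD _ hyQ).trans (le_abs_self D)) v
    have hm' : 0 < √m := Real.sqrt_pos.2 hm
    calc |dirDeriv ρ X x| ≤ |D| * ‖v‖ := by
          rw [← h1] at h4; exact h4
      _ = |D| / √m * (√m * ‖v‖) := by field_simp
      _ ≤ _ := by gcongr
  · rw [indicator_of_notMem hx]
    have h0 : ρ =ᶠ[𝓝 x] fun _ => 0 := notMem_tsupport_iff_eventuallyEq.1 hx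
    rw [dirDeriv, h0.mfderiv_eq, mfderiv_const]
    exact (abs_zero (α := ℝ)).le

end Estimates

/-! ### Variation in time, bump functions, continuity of `dρ(X)`. -/

section Variation

/-- No integrability of `u'` is required: if it fails, the right side is `⊤`. -/
theorem ofReal_abs_sub_le_lintegral {u u' : ℝ → ℝ} (hu : ContinuousOn u (Icc 0 1))
    (hu' : ∀ t ∈ Ioo (0 : ℝ) 1, HasDerivAt u (u' t) t) :
    ENNReal.ofReal |u 1 - u 0| ≤ ∫⁻ t in Ioo (0 : ℝ) 1, ENNReal.ofReal |u' t| := by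
  have hm : AEStronglyMeasurable u' (volume.restrict (Ioo (0 : ℝ) 1)) := by
    refine (stronglyMeasurable_deriv u).aestronglyMeasurable.congr ?_
    filter_upwards [ae_restrict_mem measurableSet_Ioo] with t ht using (hu' t ht).deriv
  by_cases hi : IntegrableOn u' (Ioo 0 1)
  · have h1 : IntervalIntegrable u' volume 0 1 := by
      rw [intervalIntegrable_iff_integrableOn_Ioo_of_le zero_le_one]; exact hi
    rw [← intervalIntegral.integral_eq_sub_of_hasDerivAt_of_le zero_le_one hu hu' h1,
      intervalIntegral.integral_of_le zero_le_one, integral_Ioc_eq_integral_Ioo,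
      ← ofReal_integral_eq_lintegral_ofReal hi.abs (Eventually.of_forall fun _ => abs_nonneg _)]
    exact ENNReal.ofReal_le_ofReal (abs_integral_le_integral_abs)
  · have h2 : ∫⁻ t in Ioo (0 : ℝ) 1, ENNReal.ofReal |u' t| = ⊤ := by
      by_contra hne
      refine hi ⟨hm, ?_⟩
      simp_rw [HasFiniteIntegral, Real.enorm_eq_ofReal_abs]
      exact lt_top_iff_ne_top.2 hne
    rw [h2]
    exact le_top

theorem exists_bump [T2Space N] (c : N) {U : Set N} (hU : U ∈ 𝓝 c) :
    ∃ ρ : N → ℝ, ContMDiff (𝓡 n) 𝓘(ℝ, ℝ) ∞ ρ ∧ HasCompactSupport ρ ∧ tsupport ρ ⊆ U ∧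
      tsupport ρ ⊆ (extChartAt (𝓡 n) c).source ∧ (∀ x, 0 ≤ ρ x) ∧ (∀ x, ρ x ≤ 1) ∧ ρ c = 1 := by
  obtain ⟨ρ, -, hρ⟩ := (SmoothBumpFunction.nhds_basis_tsupport (I := 𝓡 n) c).mem_iff.1 hU
  refine ⟨ρ, ρ.contMDiff, ρ.hasCompactSupport, hρ, ?_, fun x => ρ.nonneg, fun x => ρ.le_one,
    ρ.eq_one⟩
  rw [extChartAt_source]
  exact ρ.tsupport_subset_chartAt_source

theorem continuous_dirDeriv {ρ : N → ℝ} (hρ : ContMDiff (𝓡 n) 𝓘(ℝ, ℝ) ∞ ρ)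
    {X : ∀ x : N, TangentSpace (𝓡 n) x} (hX : IsSmoothField X) : Continuous (dirDeriv ρ X) := by
  rw [continuous_iff_continuousAt]
  intro x
  have hy := mem_extChartAt_target (I := 𝓡 n) x
  have h1 : ContDiffAt ℝ ∞ (fun z => ρ ((extChartAt (𝓡 n) x).symm z)) (extChartAt (𝓡 n) x x) :=
    (ContMDiffAt.comp _ (hρ _) (contMDiffAt_chart_symm hy)).contDiffAt
  have h2 : ContinuousAt (fun y => fderiv ℝ (fun z => ρ ((extChartAt (𝓡 n) x).symm z)) y
      (components x X y)) (extChartAt (𝓡 n) x x) :=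
    (h1.fderiv_right (m := ∞) (by simp)).continuousAt.clm_apply (hX x _ hy).continuousAt
  have h3 := ContinuousAt.comp (f := extChartAt (𝓡 n) x) h2 (continuousAt_extChartAt x)
  refine h3.congr ?_
  filter_upwards [(isOpen_extChartAt_source (I := 𝓡 n) x).mem_nhds (mem_extChartAt_source x)]
    with z hz
  have h4 := dirDeriv_eq_fderiv_components hρ ((extChartAt (𝓡 n) x).map_source hz) X
  rw [(extChartAt (𝓡 n) x).left_inv hz] at h4
  exact h4.symm

end Variation

/-! ### Integral bounds by `G⁰` and the splitting of `G^A`. -/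

section Metrics

variable [T2Space N] [MeasurableSpace N] [BorelSpace N]
variable {S : Set (Diff n N)} {φ₀ φ₁ : Diff n N} {φ : ℝ → Diff n N}

theorem IsSmoothPath.hasCompactSupport_inner (g : Metric n N) (hφ : IsSmoothPath S φ₀ φ₁ φ)
    {t : ℝ} (ht : t ∈ Ioo (0 : ℝ) 1) :
    HasCompactSupport (fun x => g.inner x (eulerian φ t x) (eulerian φ t x)) := by
  obtain ⟨K, hK, hK0⟩ := hφ.exists_compact_eulerian_eq_zero
  exact HasCompactSupport.intro hK fun x hx => by rw [hK0 t ht x hx, map_zero]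

theorem IsSmoothPath.hasCompactSupport_divergence (g : Metric n N)
    (hφ : IsSmoothPath S φ₀ φ₁ φ) {t : ℝ} (ht : t ∈ Ioo (0 : ℝ) 1) :
    HasCompactSupport (divergence g (eulerian φ t)) := by
  obtain ⟨K, hK, hK0⟩ := hφ.exists_compact_eulerian_eq_zero
  exact HasCompactSupport.intro hK fun x hx =>
    divergence_eq_zero g hK.isClosed.isOpen_compl (fun z hz => hK0 t ht z hz) hx

theorem IsSmoothPath.setIntegral_sqrt_inner_le (g : Metric n N) (hφ : IsSmoothPath S φ₀ φ₁ φ)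
    {t : ℝ} (ht : t ∈ Ioo (0 : ℝ) 1) {K : Set N} (hK : IsCompact K) :
    ∫ x in K, √(g.inner x (eulerian φ t x) (eulerian φ t x)) ∂(vol g) ≤
      √((vol g).real K) * √(metricH0 g (φ t) (velocity φ t) (velocity φ t)) := by
  have hc : Continuous (fun x => √(g.inner x (eulerian φ t x) (eulerian φ t x))) :=
    (continuous_inner g (hφ.isSmoothField ht)).sqrt
  have hs : HasCompactSupport (fun x => √(g.inner x (eulerian φ t x) (eulerian φ t x))) :=
    (hφ.hasCompactSupport_inner g ht).comp_left Real.sqrt_zero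
  have h := setIntegral_abs_le hK.measurableSet hK.measure_lt_top.ne
    (hc.memLp_of_hasCompactSupport (p := 2) (μ := vol g) hs)
  simp_rw [abs_of_nonneg (Real.sqrt_nonneg _), Real.sq_sqrt (inner_self_nonneg g _ _)] at h
  exact h

theorem IsSmoothPath.setIntegral_abs_divergence_le (g : Metric n N)
    (hφ : IsSmoothPath S φ₀ φ₁ φ) {t : ℝ} (ht : t ∈ Ioo (0 : ℝ) 1) {K : Set N}
    (hK : IsCompact K) :
    ∫ x in K, |divergence g (eulerian φ t) x| ∂(vol g) ≤
      √((vol g).real K) * √(∫ x, divergence g (eulerian φ t) x ^ 2 ∂(vol g)) :=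
  setIntegral_abs_le hK.measurableSet hK.measure_lt_top.ne
    ((continuous_divergence g (hφ.isSmoothField ht)).memLp_of_hasCompactSupport
      (hφ.hasCompactSupport_divergence g ht))

theorem IsSmoothPath.metricA_eq (g : Metric n N) (A : ℝ) (hφ : IsSmoothPath S φ₀ φ₁ φ) {t : ℝ}
    (ht : t ∈ Ioo (0 : ℝ) 1) :
    metricA g A (φ t) (velocity φ t) (velocity φ t) =
      metricH0 g (φ t) (velocity φ t) (velocity φ t) +
        A * ∫ x, divergence g (eulerian φ t) x ^ 2 ∂(vol g) := by
  have hX := hφ.isSmoothField ht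
  have h1 : Integrable (fun x => g.inner x (eulerian φ t x) (eulerian φ t x)) (vol g) :=
    (continuous_inner g hX).integrable_of_hasCompactSupport (hφ.hasCompactSupport_inner g ht)
  have h2 : Integrable (fun x => A * (divergence g (eulerian φ t) x *
      divergence g (eulerian φ t) x)) (vol g) :=
    (((continuous_divergence g hX).mul (continuous_divergence g hX)).integrable_of_hasCompactSupport
      (hφ.hasCompactSupport_divergence g ht).mul_left).const_mul A
  simp_rw [sq]
  rw [← integral_const_mul]
  exact integral_add h1 h2

end Metrics

/-! ### Positivity for volume preserving diffeomorphisms. -/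

section VolumePreserving

variable [T2Space N] [SecondCountableTopology N] [MeasurableSpace N] [BorelSpace N]

theorem IsSmoothPath.hasDerivAt_comp {S : Set (Diff n N)} {φ₀ φ₁ : Diff n N} {φ : ℝ → Diff n N}
    (hφ : IsSmoothPath S φ₀ φ₁ φ) {ρ : N → ℝ} (hρ : ContMDiff (𝓡 n) 𝓘(ℝ, ℝ) ∞ ρ) {t : ℝ}
    (ht : t ∈ Ioo (0 : ℝ) 1) (x : N) :
    HasDerivAt (fun s => ρ (φ s x)) (dirDeriv ρ (eulerian φ t) (φ t x)) t := by
  rw [dirDeriv, eulerian, rightTranslate_apply]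
  exact hφ.mfderiv_velocity ht ((hρ _).mdifferentiableAt (by simp))

theorem IsSmoothPath.lintegral_abs_dirDeriv_le (g : Metric n N) {S : Set (Diff n N)}
    {φ₀ φ₁ : Diff n N} {φ : ℝ → Diff n N} (hφ : IsSmoothPath S φ₀ φ₁ φ) {ρ : N → ℝ}
    (hρc : HasCompactSupport ρ) {C : ℝ} (hC : 0 ≤ C)
    (hCle : ∀ (X : ∀ x : N, TangentSpace (𝓡 n) x) (x : N), |dirDeriv ρ X x| ≤
      (tsupport ρ).indicator (fun x => C * √(g.inner x (X x) (X x))) x) {t : ℝ}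
    (ht : t ∈ Ioo (0 : ℝ) 1) :
    ∫⁻ x, ENNReal.ofReal |dirDeriv ρ (eulerian φ t) x| ∂(vol g) ≤
      ENNReal.ofReal (C * √((vol g).real (tsupport ρ))) *
        ENNReal.ofReal √(metricH0 g (φ t) (velocity φ t) (velocity φ t)) := by
  have hK := hρc.isCompact
  have hc : Continuous (fun x => √(g.inner x (eulerian φ t x) (eulerian φ t x))) :=
    (continuous_inner g (hφ.isSmoothField ht)).sqrt
  calc _ ≤ ∫⁻ x, ENNReal.ofReal ((tsupport ρ).indicator
          (fun x => C * √(g.inner x (eulerian φ t x) (eulerian φ t x))) x) ∂(vol g) :=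
        lintegral_mono fun x => ENNReal.ofReal_le_ofReal (hCle _ x)
    _ = ∫⁻ x, (tsupport ρ).indicator (fun x => ENNReal.ofReal
          (C * √(g.inner x (eulerian φ t x) (eulerian φ t x)))) x ∂(vol g) := by
        congr 1; ext x
        by_cases hx : x ∈ tsupport ρ <;> simp [hx]
    _ = ENNReal.ofReal
          (∫ x in tsupport ρ, C * √(g.inner x (eulerian φ t x) (eulerian φ t x)) ∂(vol g)) := by
        rw [lintegral_indicator hK.measurableSet]
        exact (ofReal_integral_eq_lintegral_ofReal
          ((continuous_const.mul hc).continuousOn.integrableOn_compact hK)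
          (Eventually.of_forall fun x => mul_nonneg hC (Real.sqrt_nonneg _))).symm
    _ ≤ _ := by
        rw [← ENNReal.ofReal_mul (by positivity), integral_const_mul, mul_assoc]
        exact ENNReal.ofReal_le_ofReal
          (mul_le_mul_of_nonneg_left (hφ.setIntegral_sqrt_inner_le g ht hK) hC)

theorem geodesicDist_metricH0_pos (g : Metric n N) {φ₀ φ₁ : Diff n N} (hne : φ₀ ≠ φ₁) :
    0 < geodesicDist (metricH0 g) (volDiff0 g) φ₀ φ₁ := by
  obtain ⟨x₀, hx₀⟩ : ∃ x, φ₀ x ≠ φ₁ x := by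
    by_contra! h
    exact hne (Diffeomorph.ext h)
  obtain ⟨ρ, hρ, hρc, hρU, hρs, -, -, hρ1⟩ := exists_bump (n := n) (φ₁ x₀)
    (isOpen_ne.mem_nhds hx₀.symm)
  have hρ0 : ρ (φ₀ x₀) = 0 := by
    by_contra h
    exact hρU (subset_tsupport ρ h) rfl
  obtain ⟨C, hC, hCle⟩ := exists_abs_dirDeriv_le g hρ hρc hρs
  set δ : ℝ≥0∞ := ∫⁻ x, ENNReal.ofReal |ρ (φ₁ x) - ρ (φ₀ x)| ∂(vol g) with hδ
  set C' : ℝ := C * √((vol g).real (tsupport ρ)) with hC'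
  have hcont : Continuous (fun x => ρ (φ₁ x) - ρ (φ₀ x)) :=
    (hρ.continuous.comp φ₁.continuous).sub (hρ.continuous.comp φ₀.continuous)
  have hδpos : δ ≠ 0 := by
    rw [hδ, Ne, lintegral_eq_zero_iff' hcont.abs.measurable.ennreal_ofReal.aemeasurable]
    intro h
    have h1 := (ENNReal.continuous_ofReal.comp hcont.abs).ae_eq_iff_eq (vol g) continuous_zero |>.1 h
    have h2 := congrFun h1 x₀
    simp [hρ1, hρ0] at h2
  have key : ∀ φ : ℝ → Diff n N, IsSmoothPath (volDiff0 g) φ₀ φ₁ φ →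
      δ ≤ ENNReal.ofReal C' * pathLength (metricH0 g) φ := by
    intro φ hφ
    -- Paths are constrained only on `[0, 1]`. Clamping time makes `q` continuous everywhere, which
    -- yields joint measurability of its time derivative, as Tonelli requires.
    set q : N → ℝ → ℝ := fun x t => ρ (φ (projIcc (0 : ℝ) 1 zero_le_one t) x) with hq
    have hqc : Continuous q.uncurry := by
      have h1 : Continuous (fun p : N × ℝ => ((projIcc (0 : ℝ) 1 zero_le_one p.2 : ℝ), p.1)) :=
        (continuous_subtype_val.comp (continuous_projIcc.comp continuous_snd)).prodMk continuous_fst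
      exact hρ.continuous.comp (hφ.smooth.continuousOn.comp_continuous h1
        fun p => ⟨(projIcc (0 : ℝ) 1 zero_le_one p.2).2, mem_univ _⟩)
    have hqI : ∀ x, ∀ t ∈ Icc (0 : ℝ) 1, q x t = ρ (φ t x) := fun x t ht => by
      simp only [hq, projIcc_of_mem zero_le_one ht]
    have hqd : ∀ x, ∀ t ∈ Ioo (0 : ℝ) 1,
        HasDerivAt (q x) (dirDeriv ρ (eulerian φ t) (φ t x)) t := fun x t ht =>
      (hφ.hasDerivAt_comp hρ ht x).congr_of_eventuallyEq
        (eventually_of_mem (Icc_mem_nhds ht.1 ht.2) (hqI x))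
    have hmeas : Measurable (fun p : N × ℝ => ENNReal.ofReal |deriv (q p.1) p.2|) :=
      (measurable_deriv_with_param hqc).abs.ennreal_ofReal
    calc δ ≤ ∫⁻ x, (∫⁻ t in Ioo (0 : ℝ) 1, ENNReal.ofReal |deriv (q x) t|) ∂(vol g) := by
          refine lintegral_mono fun x => ?_
          have h := ofReal_abs_sub_le_lintegral (u := q x) (u' := deriv (q x))
            (hqc.comp (Continuous.prodMk_right x)).continuousOn
            (fun t ht => (hqd x t ht).differentiableAt.hasDerivAt)
          rwa [hqI x 0 (by simp), hqI x 1 (by simp), hφ.source, hφ.target] at h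
      _ = ∫⁻ t in Ioo (0 : ℝ) 1, ∫⁻ x, ENNReal.ofReal |deriv (q x) t| ∂(vol g) :=
          lintegral_lintegral_swap hmeas.aemeasurable
      _ ≤ ∫⁻ t in Ioo (0 : ℝ) 1, ENNReal.ofReal C' *
            ENNReal.ofReal √(metricH0 g (φ t) (velocity φ t) (velocity φ t)) := by
          refine setLIntegral_mono' measurableSet_Ioo fun t ht => ?_
          simp_rw [(hqd _ t ht).deriv]
          -- This is where volume preservation of `φ t` enters.
          rw [(hφ.mem t ⟨ht.1.le, ht.2.le⟩).2.lintegral_comp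
            (f := fun x => ENNReal.ofReal |dirDeriv ρ (eulerian φ t) x|)
            (continuous_dirDeriv hρ (hφ.isSmoothField ht)).abs.measurable.ennreal_ofReal]
          exact hφ.lintegral_abs_dirDeriv_le g hρc hC hCle ht
      _ = ENNReal.ofReal C' * ∫⁻ t in Ioo (0 : ℝ) 1,
            ENNReal.ofReal √(metricH0 g (φ t) (velocity φ t) (velocity φ t)) :=
          lintegral_const_mul' _ _ ENNReal.ofReal_ne_top
      _ ≤ _ := by
          gcongr
          exact lintegral_mono_set Ioo_subset_Icc_self
  have hle : δ / ENNReal.ofReal C' ≤ geodesicDist (metricH0 g) (volDiff0 g) φ₀ φ₁ :=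
    le_iInf₂ fun φ hφ => ENNReal.div_le_of_le_mul' (key φ hφ)
  exact (ENNReal.div_pos hδpos ENNReal.ofReal_ne_top).trans_le hle

end VolumePreserving

/-! ### Extension by zero and differentiation under the integral. -/

section ExtensionByZero

theorem contDiff_of_eq_zero_off {E F : Type*} [NormedAddCommGroup E] [NormedSpace ℝ E]
    [NormedAddCommGroup F] [NormedSpace ℝ F] {Q T : Set E} (hQ : IsClosed Q) (hQT : Q ⊆ T)
    {k : WithTop ℕ∞} {v : E → F} (hv : ∀ y ∈ T, ContDiffAt ℝ k v y) (h0 : ∀ y ∉ Q, v y = 0) :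
    ContDiff ℝ k v := by
  rw [contDiff_iff_contDiffAt]
  intro y
  by_cases hy : y ∈ Q
  · exact hv y (hQT hy)
  · exact contDiffAt_const.congr_of_eventuallyEq
      (eventually_of_mem (hQ.isOpen_compl.mem_nhds hy) fun z hz => h0 z hz)

/-- The derivative of `∫ r(y) H(s, y) dy` for compactly supported `r` and smooth `H`. -/
theorem hasDerivAt_integral_mul {r : EuclideanSpace ℝ (Fin n) → ℝ}
    {H : ℝ × EuclideanSpace ℝ (Fin n) → ℝ} {J : Set ℝ} (hJ : IsOpen J)
    {Q T : Set (EuclideanSpace ℝ (Fin n))} (hQ : IsCompact Q) (hQT : Q ⊆ T)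
    (hr : Continuous r) (hr0 : ∀ y ∉ Q, r y = 0)
    (hH : ∀ s ∈ J, ∀ y ∈ T, ContDiffAt ℝ ∞ H (s, y)) {t : ℝ} (ht : t ∈ J) :
    HasDerivAt (fun s => ∫ y, r y * H (s, y)) (∫ y, r y * fderiv ℝ H (t, y) (1, 0)) t := by
  obtain ⟨ε, hε, hball⟩ := Metric.nhds_basis_closedBall.mem_iff.1 (hJ.mem_nhds ht)
  have hcont : ∀ {w : EuclideanSpace ℝ (Fin n) → ℝ}, (∀ y ∈ Q, ContinuousAt w y) →
      Continuous (fun y => r y * w y) := by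
    intro w hw
    rw [continuous_iff_continuousAt]
    intro y
    by_cases hy : y ∈ Q
    · exact hr.continuousAt.mul (hw y hy)
    · have h0 : (fun y => r y * w y) =ᶠ[𝓝 y] fun _ => 0 :=
        eventually_of_mem (hQ.isClosed.isOpen_compl.mem_nhds hy) fun z hz => by simp [hr0 z hz]
      exact continuousAt_const.congr h0.symm
  have hH1 : ∀ s ∈ J, ∀ y ∈ Q, ContinuousAt (fun z => H (s, z)) y := fun s hs y hy =>
    ContinuousAt.comp (f := fun z => (s, z)) (hH s hs y (hQT hy)).continuousAt
      (Continuous.prodMk_right s).continuousAt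
  have hH2 : ∀ s ∈ J, ∀ y ∈ Q, ContinuousAt (fun p => fderiv ℝ H p (1, 0)) (s, y) :=
    fun s hs y hy => ((hH s hs y (hQT hy)).fderiv_right (m := ∞) (by simp)).continuousAt.clm_apply
      continuousAt_const
  have hH3 : ∀ y ∈ Q, ContinuousAt (fun z => fderiv ℝ H (t, z) (1, 0)) y := fun y hy =>
    ContinuousAt.comp (f := fun z => (t, z)) (hH2 t ht y hy)
      (Continuous.prodMk_right t).continuousAt
  -- The dominating function `|r| M` comes from a bound on `∂ₛH` over a compact time interval times
  -- `Q`.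
  obtain ⟨M, hM⟩ := ((isCompact_closedBall t ε).prod hQ).exists_bound_of_continuousOn
    (f := fun p : ℝ × EuclideanSpace ℝ (Fin n) => fderiv ℝ H p (1, 0))
    (fun p hp => (hH2 p.1 (hball hp.1) p.2 hp.2).continuousWithinAt)
  have hrc : HasCompactSupport r := HasCompactSupport.intro hQ hr0
  refine (hasDerivAt_integral_of_dominated_loc_of_deriv_le
    (F := fun s y => r y * H (s, y)) (F' := fun s y => r y * fderiv ℝ H (s, y) (1, 0))
    (bound := fun y => |r y| * M) (Metric.closedBall_mem_nhds t hε) ?_ ?_ ?_ ?_ ?_ ?_).2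
  · filter_upwards [hJ.mem_nhds ht] with s hs
    exact (hcont (hH1 s hs)).aestronglyMeasurable
  · exact (hcont (hH1 t ht)).integrable_of_hasCompactSupport hrc.mul_right
  · exact (hcont hH3).aestronglyMeasurable
  · refine Eventually.of_forall fun y s hs => ?_
    by_cases hy : y ∈ Q
    · rw [norm_mul, Real.norm_eq_abs]
      exact mul_le_mul_of_nonneg_left (hM (s, y) ⟨hs, hy⟩) (abs_nonneg _)
    · simp [hr0 y hy]
  · exact (hr.integrable_of_hasCompactSupport hrc).abs.mul_const M
  · refine Eventually.of_forall fun y s hs => ?_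
    by_cases hy : y ∈ Q
    · have h1 := ((hH s (hball hs) y (hQT hy)).differentiableAt
        (by simp)).hasFDerivAt.comp_hasDerivAt s ((hasDerivAt_id s).prodMk (hasDerivAt_const s y))
      exact h1.const_mul (r y)
    · simpa [hr0 y hy] using hasDerivAt_const s (0 : ℝ)

end ExtensionByZero

/-! ### Pairing with transported functions and positivity for `G^A`. -/

section Pairing

variable [T2Space N] [MeasurableSpace N] [BorelSpace N]
variable {S : Set (Diff n N)} {φ₀ φ₁ : Diff n N} {φ : ℝ → Diff n N}

/-- The transport equation trades the time derivative for a space derivative of `f ∘ φ⁻¹`, and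
integration by parts moves it to `ρX`, where `div (ρX) = dρ(X) + ρ div X`. No derivative of `f ∘
φ⁻¹`, which would be uncontrolled, survives. -/
theorem IsSmoothPath.hasDerivAt_integral_transport (g : Metric n N)
    (hφ : IsSmoothPath S φ₀ φ₁ φ) {f ρ : N → ℝ} (hf : ContMDiff (𝓡 n) 𝓘(ℝ, ℝ) ∞ f)
    (hρ : ContMDiff (𝓡 n) 𝓘(ℝ, ℝ) ∞ ρ) (hρc : HasCompactSupport ρ) {c : N}
    (hρs : tsupport ρ ⊆ (extChartAt (𝓡 n) c).source) {t : ℝ} (ht : t ∈ Ioo (0 : ℝ) 1) :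
    HasDerivAt (fun s => ∫ x, ρ x * f ((φ s).symm x) ∂(vol g))
      (∫ x in (extChartAt (𝓡 n) c).source, f ((φ t).symm x) *
        (dirDeriv ρ (eulerian φ t) x + ρ x * divergence g (eulerian φ t) x) ∂(vol g)) t := by
  set T := (extChartAt (𝓡 n) c).target with hT
  have hTo : IsOpen T := isOpen_chartTarget c
  set Q := extChartAt (𝓡 n) c '' tsupport ρ with hQ
  have hQc : IsCompact Q := hρc.isCompact.image_of_continuousOn
    ((continuousOn_extChartAt (I := 𝓡 n) c).mono hρs)
  have hQT : Q ⊆ T := by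
    rintro _ ⟨x, hx, rfl⟩
    exact (extChartAt (𝓡 n) c).map_source (hρs hx)
  set X := eulerian φ t with hXdef
  have hX : IsSmoothField X := hφ.isSmoothField ht
  set H : ℝ × EuclideanSpace ℝ (Fin n) → ℝ := fun p =>
    f ((φ p.1).symm ((extChartAt (𝓡 n) c).symm p.2)) with hH
  have hHs : ∀ s ∈ Ioo (0 : ℝ) 1, ∀ y ∈ T, ContDiffAt ℝ ∞ H (s, y) := fun s hs y hy =>
    hφ.contDiffAt_transport hf hs hy
  -- Including the density in `r` turns integrals against `vol g` into Lebesgue integrals, and makes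
  -- the Euclidean divergence of `r X` the density times `div (ρX)`.
  set r : EuclideanSpace ℝ (Fin n) → ℝ :=
    T.indicator fun y => volDensity g c y * ρ ((extChartAt (𝓡 n) c).symm y) with hr
  have hrT : ∀ y ∈ T, r y = volDensity g c y * ρ ((extChartAt (𝓡 n) c).symm y) := fun y hy =>
    indicator_of_mem hy _
  have hr0 : ∀ y ∉ Q, r y = 0 := by
    intro y hy
    by_cases hyT : y ∈ T
    · rw [hrT y hyT, image_eq_zero_of_notMem_tsupport (f := ρ)
        fun h => hy ⟨_, h, (extChartAt (𝓡 n) c).right_inv hyT⟩, mul_zero]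
    · exact indicator_of_notMem hyT _
  have hρ' : ∀ y ∈ T, ContDiffAt ℝ ∞ (fun z => ρ ((extChartAt (𝓡 n) c).symm z)) y := fun y hy =>
    (ContMDiffAt.comp y (hρ _) (contMDiffAt_chart_symm hy)).contDiffAt
  have hrd : ∀ y ∈ T, ContDiffAt ℝ ∞ r y := fun y hy =>
    ((contDiffAt_volDensity g hy).mul (hρ' y hy)).congr_of_eventuallyEq
      (eventually_of_mem (hTo.mem_nhds hy) hrT)
  have hrs : ContDiff ℝ ∞ r := contDiff_of_eq_zero_off hQc.isClosed hQT hrd hr0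
  have hI : ∀ s, ∫ x, ρ x * f ((φ s).symm x) ∂(vol g) = ∫ y, r y * H (s, y) := by
    intro s
    have hm : Continuous (fun x => ρ x * f ((φ s).symm x)) :=
      hρ.continuous.mul (hf.continuous.comp (φ s).symm.continuous)
    rw [← setIntegral_eq_integral_of_forall_compl_eq_zero
      (s := (extChartAt (𝓡 n) c).source) (fun x hx => by
        rw [image_eq_zero_of_notMem_tsupport fun h => hx (hρs h), zero_mul]),
      setIntegral_source_vol g c hm.aestronglyMeasurable,
      ← setIntegral_eq_integral_of_forall_compl_eq_zero (s := T)
        (f := fun y => r y * H (s, y)) (fun y hy => by rw [hr, indicator_of_notMem hy, zero_mul])]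
    refine setIntegral_congr_fun hTo.measurableSet fun y hy => ?_
    simp only [hrT y hy, hH, mul_assoc]
  have hder := hasDerivAt_integral_mul isOpen_Ioo hQc hQT hrs.continuous hr0 hHs ht
  rw [funext hI]
  convert hder using 1
  set V : EuclideanSpace ℝ (Fin n) → EuclideanSpace ℝ (Fin n) := fun y =>
    r y • components c X y with hV
  have hV0 : ∀ y ∉ Q, V y = 0 := fun y hy => by simp only [hV, hr0 y hy, zero_smul]
  have hVs : ContDiff ℝ ∞ V := contDiff_of_eq_zero_off hQc.isClosed hQT
    (fun y hy => (hrd y hy).smul (hX c y hy)) hV0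
  have hVc : HasCompactSupport V := HasCompactSupport.intro hQc hV0
  have hVT : tsupport V ⊆ T :=
    (closure_minimal (fun y hy => by_contra fun h => hy (hV0 y h) : Function.support V ⊆ Q)
      hQc.isClosed).trans hQT
  have hHt : ∀ y ∈ T, HasFDerivAt (fun z => H (t, z))
      (fderiv ℝ H (t, y) ∘L ContinuousLinearMap.inr ℝ ℝ (EuclideanSpace ℝ (Fin n))) y :=
    fun y hy => ((hHs t ht y hy).differentiableAt (by simp)).hasFDerivAt.comp y
      (hasFDerivAt_prodMk_right t y)
  have h1 : ∀ y, r y * fderiv ℝ H (t, y) (1, 0) = -fderiv ℝ (fun z => H (t, z)) y (V y) := by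
    intro y
    by_cases hy : y ∈ T
    · have h2 := hφ.transport_eq hf ht hy
      have h3 : ((1, components c X y) : ℝ × EuclideanSpace ℝ (Fin n)) =
          (1, 0) + (0, components c X y) := by simp
      rw [← hXdef, ← hH, h3, map_add] at h2
      rw [(hHt y hy).fderiv, hV, map_smul, smul_eq_mul, eq_neg_of_add_eq_zero_left h2]
      simp
    · rw [hV0 y fun h => hy (hQT h), hr0 y fun h => hy (hQT h)]
      simp
  simp_rw [h1]
  rw [integral_neg, integral_fderiv_apply_eq_neg (H := fun z => H (t, z)) hTo
    (fun y hy => ((ContDiffAt.comp y (f := fun z => (t, z)) (hHs t ht y hy)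
      (contDiffAt_const.prodMk contDiffAt_id)).of_le (by simp)).contDiffWithinAt)
    (hVs.of_le (by simp)) hVc hVT, neg_neg]
  have hcm : Continuous (fun x => f ((φ t).symm x) *
      (dirDeriv ρ X x + ρ x * divergence g X x)) :=
    (hf.continuous.comp (φ t).symm.continuous).mul ((continuous_dirDeriv hρ hX).add
      (hρ.continuous.mul (continuous_divergence g hX)))
  rw [setIntegral_source_vol g c hcm.aestronglyMeasurable,
    ← setIntegral_eq_integral_of_forall_compl_eq_zero (s := T)
      (f := fun y => H (t, y) * ∑ i : Fin n, fderiv ℝ (fun z => V z i) y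
        (EuclideanSpace.single i (1 : ℝ))) (fun y hy => by
        have hev : V =ᶠ[𝓝 y] fun _ => 0 :=
          eventually_of_mem (hQc.isClosed.isOpen_compl.mem_nhds fun h => hy (hQT h)) hV0
        refine mul_eq_zero_of_right _ (Finset.sum_eq_zero fun i _ => ?_)
        have hev' : (fun z => V z i) =ᶠ[𝓝 y] fun _ => 0 := hev.mono fun z hz => by simp [hz]
        rw [hev'.fderiv_eq]
        simp)]
  refine setIntegral_congr_fun hTo.measurableSet fun y hy => ?_
  have hσ := (volDensity_pos g hy).ne'
  have hsrc := (extChartAt (𝓡 n) c).map_target hy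
  have hcomp : ∀ i, DifferentiableAt ℝ (fun z => volDensity g c z * components c X z i) y :=
    fun i => ((contDiffAt_volDensity g hy).mul
      ((EuclideanSpace.proj i : EuclideanSpace ℝ (Fin n) →L[ℝ] ℝ).contDiff.contDiffAt.comp y
        (hX c y hy))).differentiableAt (by simp)
  have hVi : ∀ i, fderiv ℝ (fun z => V z i) y (EuclideanSpace.single i (1 : ℝ)) =
      volDensity g c y * (components c X y i *
        fderiv ℝ (fun z => ρ ((extChartAt (𝓡 n) c).symm z)) y (EuclideanSpace.single i (1 : ℝ))) +
      ρ ((extChartAt (𝓡 n) c).symm y) *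
        fderiv ℝ (fun z => volDensity g c z * components c X z i) y
          (EuclideanSpace.single i (1 : ℝ)) := by
    intro i
    have hev : (fun z => V z i) =ᶠ[𝓝 y] fun z => ρ ((extChartAt (𝓡 n) c).symm z) *
        (volDensity g c z * components c X z i) := by
      filter_upwards [hTo.mem_nhds hy] with z hz
      simp only [hV, hrT z hz, PiLp.smul_apply, smul_eq_mul]
      ring
    rw [hev.fderiv_eq, fderiv_fun_mul ((hρ' y hy).differentiableAt (by simp)) (hcomp i)]
    simp only [add_apply, smul_apply, smul_eq_mul]
    ring
  have hdir : dirDeriv ρ X ((extChartAt (𝓡 n) c).symm y) = ∑ i, components c X y i *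
      fderiv ℝ (fun z => ρ ((extChartAt (𝓡 n) c).symm z)) y (EuclideanSpace.single i (1 : ℝ)) := by
    rw [dirDeriv_eq_fderiv_components hρ hy]
    have h : components c X y = ∑ i, components c X y i • EuclideanSpace.single i (1 : ℝ) := by
      simpa using ((EuclideanSpace.basisFun (Fin n) ℝ).sum_repr (components c X y)).symm
    conv_lhs => rw [h]
    simp
  have hdiv : volDensity g c y * divergence g X ((extChartAt (𝓡 n) c).symm y) =
      ∑ i : Fin n, fderiv ℝ (fun z => volDensity g c z * components c X z i) y
        (EuclideanSpace.single i (1 : ℝ)) := by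
    rw [divergence_eq_chartDivergence g hX hsrc, (extChartAt (𝓡 n) c).right_inv hy,
      chartDivergence, mul_inv_cancel_left₀ hσ]
  simp only [hH]
  simp_rw [hVi]
  rw [Finset.sum_add_distrib, ← Finset.mul_sum, ← Finset.mul_sum, ← hdir, ← hdiv]
  ring

theorem IsSmoothPath.continuousOn_integral_transport (g : Metric n N)
    (hφ : IsSmoothPath S φ₀ φ₁ φ) {f ρ : N → ℝ} (hf : Continuous f) (hf1 : ∀ x, |f x| ≤ 1)
    (hρ : Continuous ρ) (hρc : HasCompactSupport ρ) :
    ContinuousOn (fun s => ∫ x, ρ x * f ((φ s).symm x) ∂(vol g)) (Icc 0 1) := by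
  refine continuousOn_of_dominated (bound := fun x => |ρ x|) (fun s _ => ?_) (fun s _ => ?_)
    (hρ.integrable_of_hasCompactSupport hρc).abs ?_
  · exact (hρ.mul (hf.comp (φ s).symm.continuous)).aestronglyMeasurable
  · refine Eventually.of_forall fun x => ?_
    rw [norm_mul, Real.norm_eq_abs, Real.norm_eq_abs]
    exact mul_le_of_le_one_right (abs_nonneg _) (hf1 _)
  · exact Eventually.of_forall fun x =>
      continuousOn_const.mul (hf.comp_continuousOn (hφ.continuousOn_symm x))

theorem IsSmoothPath.abs_integral_transport_deriv_le (g : Metric n N) {A : ℝ} (hA : 0 < A)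
    (hφ : IsSmoothPath S φ₀ φ₁ φ) {f ρ : N → ℝ} (hf1 : ∀ x, |f x| ≤ 1)
    (hρ1 : ∀ x, |ρ x| ≤ 1) (hρc : HasCompactSupport ρ)
    {U : Set N} (hρU : tsupport ρ ⊆ U) {C : ℝ} (hC : 0 ≤ C)
    (hCle : ∀ (X : ∀ x : N, TangentSpace (𝓡 n) x) (x : N), |dirDeriv ρ X x| ≤
      (tsupport ρ).indicator (fun x => C * √(g.inner x (X x) (X x))) x) {t : ℝ}
    (ht : t ∈ Ioo (0 : ℝ) 1) :
    |∫ x in U, f ((φ t).symm x) *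
        (dirDeriv ρ (eulerian φ t) x + ρ x * divergence g (eulerian φ t) x) ∂(vol g)| ≤
      (√((vol g).real (tsupport ρ)) * (C + (√A)⁻¹)) *
        √(metricA g A (φ t) (velocity φ t) (velocity φ t)) := by
  set X := eulerian φ t with hXdef
  have hX : IsSmoothField X := hφ.isSmoothField ht
  set K := tsupport ρ with hKdef
  have hK : IsCompact K := hρc.isCompact
  have hc1 : Continuous (fun x => C * √(g.inner x (X x) (X x))) :=
    continuous_const.mul (continuous_inner g hX).sqrt
  have hc2 : Continuous (fun x => |divergence g X x|) := (continuous_divergence g hX).abs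
  have hi1 := hc1.continuousOn.integrableOn_compact (μ := vol g) hK
  have hi2 := hc2.continuousOn.integrableOn_compact (μ := vol g) hK
  have hi12 : IntegrableOn (fun x => C * √(g.inner x (X x) (X x)) + |divergence g X x|) K
      (vol g) := hi1.add hi2
  set D := ∫ x, divergence g X x ^ 2 ∂(vol g) with hD
  set G0 := metricH0 g (φ t) (velocity φ t) (velocity φ t) with hG0
  have hD0 : 0 ≤ D := integral_nonneg fun x => sq_nonneg _
  have hG00 : 0 ≤ G0 := integral_nonneg fun x => inner_self_nonneg g _ _
  have hpt : ∀ x, |f ((φ t).symm x) * (dirDeriv ρ X x + ρ x * divergence g X x)| ≤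
      K.indicator (fun x => C * √(g.inner x (X x) (X x)) + |divergence g X x|) x := by
    intro x
    have h1 : |dirDeriv ρ X x + ρ x * divergence g X x| ≤
        K.indicator (fun x => C * √(g.inner x (X x) (X x)) + |divergence g X x|) x := by
      refine (abs_add_le _ _).trans ?_
      rw [abs_mul]
      by_cases hx : x ∈ K
      · have h2 := hCle X x
        rw [indicator_of_mem hx] at h2 ⊢
        exact add_le_add h2 (mul_le_of_le_one_left (abs_nonneg _) (hρ1 x))
      · have h2 := hCle X x
        rw [indicator_of_notMem hx] at h2 ⊢
        rw [image_eq_zero_of_notMem_tsupport hx]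
        simpa using h2
    rw [abs_mul]
    exact (mul_le_of_le_one_left (abs_nonneg _) (hf1 _)).trans h1
  have hb1 : ∫ x in K, C * √(g.inner x (X x) (X x)) ∂(vol g) ≤ C * (√((vol g).real K) * √G0) := by
    rw [integral_const_mul]
    exact mul_le_mul_of_nonneg_left (hφ.setIntegral_sqrt_inner_le g ht hK) hC
  have hb2 : ∫ x in K, |divergence g X x| ∂(vol g) ≤ √((vol g).real K) * √D :=
    hφ.setIntegral_abs_divergence_le g ht hK
  have hGA : metricA g A (φ t) (velocity φ t) (velocity φ t) = G0 + A * D :=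
    hφ.metricA_eq g A ht
  -- `G⁰` and `A * D` are both nonnegative, so each is at most `G^A`; the second gives the factor
  -- `1/√A`.
  have hs1 : √G0 ≤ √(G0 + A * D) := Real.sqrt_le_sqrt (by nlinarith)
  have hs2 : √D ≤ (√A)⁻¹ * √(G0 + A * D) := by
    have hA' : 0 < √A := Real.sqrt_pos.2 hA
    rw [← div_eq_inv_mul, le_div_iff₀ hA', ← Real.sqrt_mul hD0]
    exact Real.sqrt_le_sqrt (by nlinarith)
  calc |∫ x in U, f ((φ t).symm x) * (dirDeriv ρ X x + ρ x * divergence g X x) ∂(vol g)|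
      ≤ ∫ x in U, K.indicator
          (fun x => C * √(g.inner x (X x) (X x)) + |divergence g X x|) x ∂(vol g) := by
        rw [← Real.norm_eq_abs]
        exact norm_integral_le_of_norm_le (hi12.integrable_indicator hK.measurableSet).restrict
          (Eventually.of_forall hpt)
    _ = ∫ x in K, (C * √(g.inner x (X x) (X x)) + |divergence g X x|) ∂(vol g) := by
        rw [setIntegral_indicator hK.measurableSet, inter_eq_right.2 hρU]
    _ = ∫ x in K, C * √(g.inner x (X x) (X x)) ∂(vol g) +
          ∫ x in K, |divergence g X x| ∂(vol g) := integral_add hi1 hi2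
    _ ≤ C * (√((vol g).real K) * √G0) + √((vol g).real K) * √D := add_le_add hb1 hb2
    _ ≤ C * (√((vol g).real K) * √(G0 + A * D)) +
          √((vol g).real K) * ((√A)⁻¹ * √(G0 + A * D)) := by gcongr
    _ = _ := by rw [hGA]; ring

theorem geodesicDist_metricA_pos (g : Metric n N) {A : ℝ} (hA : 0 < A) (S : Set (Diff n N))
    {φ₀ φ₁ : Diff n N} (hne : φ₀ ≠ φ₁) : 0 < geodesicDist (metricA g A) S φ₀ φ₁ := by
  obtain ⟨c, hc⟩ : ∃ c, φ₀.symm c ≠ φ₁.symm c := by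
    by_contra! h
    refine hne (Diffeomorph.ext fun x => ?_)
    have := h (φ₀ x)
    rw [φ₀.symm_apply_apply] at this
    rw [this, φ₁.apply_symm_apply, ← this]
  obtain ⟨f, hf, -, hfU, -, hf0, hf1, hfc⟩ := exists_bump (n := n) (φ₁.symm c)
    (isOpen_ne.mem_nhds hc.symm)
  have hf1' : ∀ x, |f x| ≤ 1 := fun x => by rw [abs_of_nonneg (hf0 x)]; exact hf1 x
  have hf00 : f (φ₀.symm c) = 0 := by
    by_contra h
    exact hfU (subset_tsupport f h) rfl
  set k : N → ℝ := fun x => f (φ₁.symm x) - f (φ₀.symm x) with hk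
  have hkc : Continuous k := (hf.continuous.comp φ₁.symm.continuous).sub
    (hf.continuous.comp φ₀.symm.continuous)
  have hk1 : k c = 1 := by simp [hk, hfc, hf00]
  -- Supporting `ρ` where `k > 0` gives `ρ k ≥ 0`, with value `1` at `c`; hence `δ > 0`.
  have hkU : {x | 0 < k x} ∈ 𝓝 c :=
    hkc.continuousAt.eventually_const_lt (by rw [hk1]; exact zero_lt_one)
  obtain ⟨ρ, hρ, hρc, hρU, hρs, hρ0, hρ1, hρc1⟩ := exists_bump (n := n) c hkU
  have hρ1' : ∀ x, |ρ x| ≤ 1 := fun x => by rw [abs_of_nonneg (hρ0 x)]; exact hρ1 x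
  obtain ⟨C, hC, hCle⟩ := exists_abs_dirDeriv_le g hρ hρc hρs
  have hintegrable : ∀ ψ : Diff n N, Integrable (fun x => ρ x * f (ψ.symm x)) (vol g) := fun ψ =>
    (hρ.continuous.mul (hf.continuous.comp ψ.symm.continuous)).integrable_of_hasCompactSupport
      hρc.mul_right
  set δ : ℝ := ∫ x, ρ x * f (φ₁.symm x) ∂(vol g) - ∫ x, ρ x * f (φ₀.symm x) ∂(vol g) with hδ
  have hδpos : 0 < δ := by
    have h1 : δ = ∫ x, ρ x * k x ∂(vol g) := by
      rw [hδ, ← integral_sub (hintegrable φ₁) (hintegrable φ₀)]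
      simp only [hk, mul_sub]
    rw [h1]
    refine (hρ.continuous.mul hkc).integral_pos_of_hasCompactSupport_nonneg_nonzero
      hρc.mul_right (fun x => ?_) (x := c) (by rw [hρc1, hk1]; norm_num)
    by_cases hx : x ∈ tsupport ρ
    · exact mul_nonneg (hρ0 x) (hρU hx).le
    · simp [image_eq_zero_of_notMem_tsupport hx]
  set C' : ℝ := √((vol g).real (tsupport ρ)) * (C + (√A)⁻¹) with hC'
  have hC'0 : 0 ≤ C' := by positivity
  have key : ∀ φ : ℝ → Diff n N, IsSmoothPath S φ₀ φ₁ φ →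
      ENNReal.ofReal δ ≤ ENNReal.ofReal C' * pathLength (metricA g A) φ := by
    intro φ hφ
    have h1 := ofReal_abs_sub_le_lintegral
      (hφ.continuousOn_integral_transport g hf.continuous hf1' hρ.continuous hρc)
      (fun t ht => hφ.hasDerivAt_integral_transport g hf hρ hρc hρs ht)
    rw [hφ.source, hφ.target, abs_of_pos hδpos] at h1
    refine h1.trans ?_
    calc _ ≤ ∫⁻ t in Ioo (0 : ℝ) 1, ENNReal.ofReal C' *
          ENNReal.ofReal √(metricA g A (φ t) (velocity φ t) (velocity φ t)) := by
          refine setLIntegral_mono' measurableSet_Ioo fun t ht => ?_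
          rw [← ENNReal.ofReal_mul hC'0]
          exact ENNReal.ofReal_le_ofReal (hφ.abs_integral_transport_deriv_le g hA hf1'
            hρ1' hρc hρs hC hCle ht)
      _ = ENNReal.ofReal C' * ∫⁻ t in Ioo (0 : ℝ) 1,
            ENNReal.ofReal √(metricA g A (φ t) (velocity φ t) (velocity φ t)) :=
          lintegral_const_mul' _ _ ENNReal.ofReal_ne_top
      _ ≤ _ := by
          gcongr
          exact lintegral_mono_set Ioo_subset_Icc_self
  -- The lower bound `δ / C'` depends on the end points and `A`, not on the path, so it passes to
  -- the infimum.
  have hle : ENNReal.ofReal δ / ENNReal.ofReal C' ≤ geodesicDist (metricA g A) S φ₀ φ₁ :=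
    le_iInf₂ fun φ hφ => ENNReal.div_le_of_le_mul' (key φ hφ)
  exact (ENNReal.div_pos (ENNReal.ofReal_pos.2 hδpos).ne' ENNReal.ofReal_ne_top).trans_le hle

end Pairing

end DiffGroup

end

theorem theorem5p7 {n : ℕ} {N : Type*} [TopologicalSpace N] [T2Space N]
    [SecondCountableTopology N] [ConnectedSpace N] [ChartedSpace (EuclideanSpace ℝ (Fin n)) N]
    [IsManifold (𝓡 n) ∞ N] [MeasurableSpace N] [BorelSpace N] (g : DiffGroup.Metric n N) :
    (∀ A : ℝ, 0 < A → ∀ φ₀ ∈ DiffGroup.diff0 n N, ∀ φ₁ ∈ DiffGroup.diff0 n N, φ₀ ≠ φ₁ →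
      0 < DiffGroup.geodesicDist (DiffGroup.metricA g A) (DiffGroup.diff0 n N) φ₀ φ₁) ∧
    (∀ φ₀ ∈ DiffGroup.volDiff0 g, ∀ φ₁ ∈ DiffGroup.volDiff0 g, φ₀ ≠ φ₁ →
      0 < DiffGroup.geodesicDist (DiffGroup.metricH0 g) (DiffGroup.volDiff0 g) φ₀ φ₁) := by
  exact ⟨fun A hA φ₀ _ φ₁ _ hne => DiffGroup.geodesicDist_metricA_pos g hA _ hne,
    fun φ₀ _ φ₁ _ hne => DiffGroup.geodesicDist_metricH0_pos g hne⟩
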